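/- **Setting.** Let $G$ be a connected real Lie group with Lie algebra $\mathfrak g$, and for $X\in\mathfrak g$ let $\eta_X=-(R_g)_*X$ be the right-invariant vector field in the direction $X$, so that $[\eta_X,\eta_Y]=\eta_{[X,Y]}$. Let $F$ be a closed right-invariant 2-form on $G$, and $\mathbf F(X,Y)=F((R_g)_*X,(R_g)_*Y)=F(\eta_X,\eta_Y)$ the corresponding 2-cocycle (its values are constants). For an open set $V\subseteq G$, a $1$-cochain on $V$ is a linear map $\mathbf A:\mathfrak g\to C^\infty(V)$; put $\delta\varphi(X)=\eta_X\varphi$ for $\varphi\in C^\infty(V)$ and $$\delta\mathbf A(X,Y)=\eta_X\mathbf A(Y)-\eta_Y\mathbf A(X)-\mathbf A([X,Y]).$$ Let $\pi:\widetilde G\to G$ be a central extension of $G$ with one-dimensional central subgroup $T$: $\widetilde G$ is a connected Lie group, $\pi$ is a smooth surjective homomorphism, $T$ is a central subgroup of $\widetilde G$ with $T=\ker\pi$ (or, more generally, with $T$ open in $\ker\pi$), and the Lie algebra of $\widetilde G$ is identified with $\widetilde{\mathfrak g}=\mathfrak g\oplus\mathbb R Z$ with the bracket $$[X+aZ,\,Y+bZ]=[X,Y]+\mathbf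 F(X,Y)\,Z\qquad (X,Y\in\mathfrak g,\ a,b\in\mathbb R),$$ in such a way that $d\pi(X+aZ)=X$. For $X\in\mathfrak g$ let $\widetilde\eta_X=-(R_{\tilde g})_*X$ be the right-invariant vector field on $\widetilde G$, and likewise $\widetilde\eta_Z$. Let $s:V\to\widetilde G$ be a smooth section of $\pi$ over an open set $V\subseteq G$. Let $T_0$ be a neighbourhood of $1$ in $T$, open in $T$ (for example $T_0=T$), and let $U:T_0\to\mathbb R\setminus\{0\}$ be a continuous one-dimensional (local) representation, $U(tt')=U(t)U(t')$ whenever $t,t',tt'\in T_0$, normalized by $\frac{d}{d\tau}\big|_{\tau=0}U(\exp \tau Z)=-1$ (that is, $U(\exp\tau Z)=e^{-\tau}$ near $\tau=0$). Extend $U$ to the function $U(s(g)t)=U(t)$, $g\in V$, $t\in T_0$. **Statement.** 1. $U$ is smooth near every point $s(g)t$ with $g\in V$, $t\in T_0$, and for all $X\in\mathfrak g$ the function $U^{-1}\,\widetilde\eta_XU$ does not depend on $t$: its value at $s(g)t$ is its value at $s(g)$. It thus defines a function $U^{-1}\widetilde\eta_XU\big|_G$ on $V$. 2. For every $\varphi\in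 C^\infty(V)$, $$\mathbf A(X)=U^{-1}\,\widetilde\eta_X U\big|_G+\delta\varphi(X)\qquad(X\in\mathfrak g)$$ is a $1$-cochain on $V$ and satisfies $\delta\mathbf A=\mathbf F$ on $V$. 3. If $V$ is simply connected, every $1$-cochain $\mathbf A$ on $V$ with $\delta\mathbf A=\mathbf F$ on $V$ has this form for some $\varphi\in C^\infty(V)$. 4. Let $\{e_a\}$ be a basis of $\mathfrak g$ and write $\eta_a=\eta_{e_a}$, $\widetilde\eta_a=\widetilde\eta_{e_a}$. In the coordinates $(g,g^0)\mapsto s(g)\exp(g^0Z)$, where $g\in V$, one has $$\widetilde\eta_Z=-\frac{\partial}{\partial g^0},\qquad \widetilde\eta_a=\eta_a+\widetilde\eta_a^{\,0}(g)\,\frac{\partial}{\partial g^0},$$ with uniquely determined coefficients $\widetilde\eta_a^{\,0}$, which depend on $g\in V$ only, and the components $\mathbf A_a=\mathbf A(e_a)$ of the cochains in 2 are $$\mathbf A_a=-\widetilde\eta_a^{\,0}+\eta_a\varphi .$$ -/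

import Mathlib

open scoped Manifold ContDiff

noncomputable section

namespace MagneticLie

section Basic

variable {E : Type*} [NormedAddCommGroup E] [NormedSpace ℝ E]
  {G : Type*} [TopologicalSpace G] [ChartedSpace E G] [Group G]

/-- The right-invariant vector field `η_X = -(R_g)_* X` in the direction of the element `X` of the
Lie algebra (the tangent space at `1`, with the bracket coming from left-invariant vector fields).
With this sign, `X ↦ η_X` is the left regular representation of the Lie algebra. -/
def rightField (X : GroupLieAlgebra 𝓘(ℝ, E) G) (g : G) : TangentSpace 𝓘(ℝ, E) g :=
  -(mfderiv 𝓘(ℝ, E) 𝓘(ℝ, E) (fun h : G => h * g) 1 X : E)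

/-- The derivative `η_X f` of a real function along the right-invariant vector field `η_X`. -/
def rightDeriv (X : GroupLieAlgebra 𝓘(ℝ, E) G) (f : G → ℝ) (g : G) : ℝ :=
  mfderiv 𝓘(ℝ, E) 𝓘(ℝ, ℝ) f g (rightField X g)

theorem rightDeriv_add_left (X Y : GroupLieAlgebra 𝓘(ℝ, E) G) (f : G → ℝ) (g : G) :
    rightDeriv (X + Y) f g = rightDeriv X f g + rightDeriv Y f g := by
  have h : rightField (X + Y) g = rightField X g + rightField Y g := by
    unfold rightField
    erw [map_add, neg_add]
    rfl
  unfold rightDeriv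
  rw [h]
  exact map_add _ _ _

theorem rightDeriv_smul_left (a : ℝ) (X : GroupLieAlgebra 𝓘(ℝ, E) G) (f : G → ℝ) (g : G) :
    rightDeriv (a • X) f g = a * rightDeriv X f g := by
  have h : rightField (a • X) g = a • rightField X g := by
    unfold rightField
    erw [map_smul]
    exact (smul_neg a _).symm
  unfold rightDeriv
  rw [h]
  exact map_smul _ _ _

/-- Real functions on `G` that are smooth on the open set `V`. -/
def IsSmoothOn (V : Set G) (f : G → ℝ) : Prop :=
  ContMDiffOn 𝓘(ℝ, E) 𝓘(ℝ, ℝ) ∞ f V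

/-- A `1`-cochain of the Lie algebra with values in `C^∞(V)`: a linear map to functions, with values
that are smooth on `V`. (Values outside `V` are irrelevant and never used.) -/
def IsOneCochain (V : Set G) (A : GroupLieAlgebra 𝓘(ℝ, E) G →ₗ[ℝ] (G → ℝ)) : Prop :=
  ∀ X, IsSmoothOn (E := E) V (A X)

/-- The coboundary of a `0`-cochain: `(δφ)(X) = η_X φ`. -/
def coboundaryZero (φ : G → ℝ) : GroupLieAlgebra 𝓘(ℝ, E) G →ₗ[ℝ] (G → ℝ) where
  toFun X g := rightDeriv X φ g
  map_add' X Y := funext fun g => rightDeriv_add_left X Y φ g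
  map_smul' a X := funext fun g => rightDeriv_smul_left a X φ g

/-- The coboundary of a `1`-cochain: `(δA)(X, Y) = η_X A(Y) - η_Y A(X) - A([X, Y])`. -/
def coboundaryOne (A : GroupLieAlgebra 𝓘(ℝ, E) G →ₗ[ℝ] (G → ℝ))
    (X Y : GroupLieAlgebra 𝓘(ℝ, E) G) (g : G) : ℝ :=
  rightDeriv X (A Y) g - rightDeriv Y (A X) g - A ⁅X, Y⁆ g

variable (E G) in
/-- A field of bilinear forms on the tangent spaces of `G`. -/
abbrev BilinField : Type _ :=
  ∀ g : G, TangentSpace 𝓘(ℝ, E) g →ₗ[ℝ] TangentSpace 𝓘(ℝ, E) g →ₗ[ℝ] ℝ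

/-- The `2`-cochain `𝐅(X, Y)(g) = F_g((R_g)_* X, (R_g)_* Y) = F_g(η_X, η_Y)` of a `2`-form `F`. -/
def cochainOfForm (F : BilinField E G) (X Y : GroupLieAlgebra 𝓘(ℝ, E) G) (g : G) : ℝ :=
  F g (rightField X g) (rightField Y g)

/-- Right-invariance `(R_g)^* F = F`. -/
def IsRightInvariant (F : BilinField E G) : Prop :=
  ∀ (g h : G) (u v : TangentSpace 𝓘(ℝ, E) h),
    F (h * g) (mfderiv 𝓘(ℝ, E) 𝓘(ℝ, E) (fun k : G => k * g) h u)
      (mfderiv 𝓘(ℝ, E) 𝓘(ℝ, E) (fun k : G => k * g) h v) = F h u v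

/-- Smooth vector fields on `G`. -/
def IsSmoothField [IsManifold 𝓘(ℝ, E) 1 G] (X : ∀ g : G, TangentSpace 𝓘(ℝ, E) g) : Prop :=
  ContMDiff 𝓘(ℝ, E) 𝓘(ℝ, E).tangent ∞
    (fun g => (⟨g, X g⟩ : TangentBundle 𝓘(ℝ, E) G))

/-- One term `X(F(Y, Z)) - F([X, Y], Z)` of the invariant formula for the exterior derivative. -/
def extDerivTerm (F : BilinField E G) (X Y Z : ∀ g : G, TangentSpace 𝓘(ℝ, E) g) (g : G) : ℝ :=
  (show ℝ from mfderiv 𝓘(ℝ, E) 𝓘(ℝ, ℝ) (fun h => F h (Y h) (Z h)) g (X g))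
    - F g (VectorField.mlieBracket 𝓘(ℝ, E) X Y g) (Z g)

/-- A `2`-form `F` is closed: `dF(X, Y, Z) = 0` for all smooth vector fields, with `dF` given by
the cyclic sum of `X(F(Y, Z)) - F([X, Y], Z)`. -/
def IsClosedForm [IsManifold 𝓘(ℝ, E) 1 G] (F : BilinField E G) : Prop :=
  ∀ X Y Z : (∀ g : G, TangentSpace 𝓘(ℝ, E) g),
    IsSmoothField X → IsSmoothField Y → IsSmoothField Z → ∀ g : G,
      extDerivTerm F X Y Z g + extDerivTerm F Y Z X g + extDerivTerm F Z X Y g = 0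

/-- `c` is the one-parameter subgroup `τ ↦ exp(τ Z)`. -/
structure IsOneParameterSubgroup (c : ℝ → G) (Z : GroupLieAlgebra 𝓘(ℝ, E) G) : Prop where
  contMDiff : ContMDiff 𝓘(ℝ, ℝ) 𝓘(ℝ, E) ∞ c
  map_zero : c 0 = 1
  map_add : ∀ σ τ, c (σ + τ) = c σ * c τ
  velocity : (mfderiv 𝓘(ℝ, ℝ) 𝓘(ℝ, E) c 0 (1 : ℝ) : E) = (Z : E)

/-- The bracket `[(X, a), (Y, b)] = ([X, Y], B(X, Y))` on the central extension `𝔤 ⊕ ℝ` of the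
Lie algebra by the bilinear form `B`. -/
def extBracket (B : GroupLieAlgebra 𝓘(ℝ, E) G →ₗ[ℝ] GroupLieAlgebra 𝓘(ℝ, E) G →ₗ[ℝ] ℝ)
    (p q : GroupLieAlgebra 𝓘(ℝ, E) G × ℝ) : GroupLieAlgebra 𝓘(ℝ, E) G × ℝ :=
  (⁅p.1, q.1⁆, B p.1 q.1)

end Basic

section Extension

variable {E : Type*} [NormedAddCommGroup E] [NormedSpace ℝ E]
  {G : Type*} [TopologicalSpace G] [ChartedSpace E G] [Group G]
  {E' : Type*} [NormedAddCommGroup E'] [NormedSpace ℝ E']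
  {G' : Type*} [TopologicalSpace G'] [ChartedSpace E' G'] [Group G']

variable (G') in
/-- `G'` is a central extension of `G` by a one-dimensional central subgroup `T`, with Lie algebra
`𝔤 ⊕ ℝ Z` and the bracket twisted by the `2`-cocycle `B`.
The subgroup `T` is `ker π`, or more generally any open subgroup of `ker π` that is central in
`G'`; then `G' / T` is a covering group of `G`, which is as good for local constructions on `G`
and has the advantage that such a `G'` exists for all `G` and `B`. -/
structure CentralExtension
    (B : GroupLieAlgebra 𝓘(ℝ, E) G →ₗ[ℝ] GroupLieAlgebra 𝓘(ℝ, E) G →ₗ[ℝ] ℝ) where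
  /-- the projection `π` -/
  proj : G' →* G
  contMDiff_proj : ContMDiff 𝓘(ℝ, E') 𝓘(ℝ, E) ∞ proj
  surjective_proj : Function.Surjective proj
  /-- the central subgroup -/
  T : Subgroup G'
  T_le_center : T ≤ Subgroup.center G'
  T_le_ker : T ≤ proj.ker
  T_open : ∃ O : Set G', IsOpen O ∧ 1 ∈ O ∧ ∀ h ∈ O, proj h = 1 → h ∈ T
  /-- the identification of `𝔤 ⊕ ℝ` with the Lie algebra of `G'` -/
  lie : (GroupLieAlgebra 𝓘(ℝ, E) G × ℝ) ≃ₗ[ℝ] GroupLieAlgebra 𝓘(ℝ, E') G'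
  lie_bracket : ∀ p q, ⁅lie p, lie q⁆ = lie (extBracket B p q)
  mfderiv_proj : ∀ p, (mfderiv 𝓘(ℝ, E') 𝓘(ℝ, E) proj 1 (lie p) : E) = (p.1 : E)

namespace CentralExtension

variable {B : GroupLieAlgebra 𝓘(ℝ, E) G →ₗ[ℝ] GroupLieAlgebra 𝓘(ℝ, E) G →ₗ[ℝ] ℝ}

/-- The generator `Z` of the Lie algebra of `T`. -/
def Z (P : CentralExtension (E' := E') G' B) : GroupLieAlgebra 𝓘(ℝ, E') G' := P.lie (0, 1)

/-- An element `X` of `𝔤`, viewed in the Lie algebra `𝔤 ⊕ ℝ Z` of `G'`. -/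
def lift (P : CentralExtension (E' := E') G' B) (X : GroupLieAlgebra 𝓘(ℝ, E) G) :
    GroupLieAlgebra 𝓘(ℝ, E') G' := P.lie (X, 0)

/-- `s` is a smooth section of the projection over the open set `V`. -/
structure IsSection (P : CentralExtension (E' := E') G' B) (V : Set G) (s : G → G') : Prop where
  isOpen : IsOpen V
  contMDiffOn : ContMDiffOn 𝓘(ℝ, E) 𝓘(ℝ, E') ∞ s V
  proj_apply : ∀ g ∈ V, P.proj (s g) = g

/-- `χ` is a continuous one-dimensional real representation of the group `T`, or only of the
neighbourhood `T₀` of `1` in `T` (take `T₀ = T` for a representation of the whole of `T`). -/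
structure IsCharacter (P : CentralExtension (E' := E') G' B) (T₀ : Set G') (χ : G' → ℝ) :
    Prop where
  relOpen : ∃ O : Set G', IsOpen O ∧ T₀ = O ∩ P.T
  one_mem : 1 ∈ T₀
  continuousOn : ContinuousOn χ T₀
  ne_zero : ∀ t ∈ T₀, χ t ≠ 0
  map_mul : ∀ t ∈ T₀, ∀ t' ∈ T₀, t * t' ∈ T₀ → χ (t * t') = χ t * χ t'

/-- The function on `G'` given by `s(g) t ↦ χ(t)`. -/
def fibreFun (P : CentralExtension (E' := E') G' B) (s : G → G') (χ : G' → ℝ) (h : G') : ℝ :=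
  χ ((s (P.proj h))⁻¹ * h)

/-- The logarithmic derivative `U⁻¹ (η̃_X U)` at a point of `G'`, for `X` in `𝔤`. -/
def logDeriv (P : CentralExtension (E' := E') G' B) (U : G' → ℝ)
    (X : GroupLieAlgebra 𝓘(ℝ, E) G) (h : G') : ℝ :=
  (U h)⁻¹ * rightDeriv (P.lift X) U h

/-- The `1`-cochain `X ↦ U⁻¹ (η̃_X U) |_G`, where the restriction to `G` is the pull-back along the
section `s`, and `U` is the function `s(g) t ↦ χ(t)`. -/
def potential (P : CentralExtension (E' := E') G' B) (s : G → G') (χ : G' → ℝ) :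
    GroupLieAlgebra 𝓘(ℝ, E) G →ₗ[ℝ] (G → ℝ) where
  toFun X g := P.logDeriv (P.fibreFun s χ) X (s g)
  map_add' X Y := by
    funext g
    have h : P.lift (X + Y) = P.lift X + P.lift Y := by
      simp only [lift, ← map_add, Prod.mk_add_mk, add_zero]
    simp only [logDeriv, h, rightDeriv_add_left, mul_add, Pi.add_apply]
  map_smul' a X := by
    funext g
    have h : P.lift (a • X) = a • P.lift X := by
      simp only [lift, ← map_smul, Prod.smul_mk, smul_zero]
    simp only [logDeriv, h, rightDeriv_smul_left, Pi.smul_apply, smul_eq_mul, RingHom.id_apply]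
    ring

/-- The vector `v + r ∂/∂g⁰` at the point `s(g) exp(τ Z)` in the coordinates
`(g, g⁰) ↦ s(g) exp(g⁰ Z)`, where `v` is tangent to `G` at `g` and `c(τ) = exp(τ Z)`. -/
def coordVector (s : G → G') (c : ℝ → G') (g : G) (τ : ℝ) (v : TangentSpace 𝓘(ℝ, E) g) (r : ℝ) :
    TangentSpace 𝓘(ℝ, E') (s g * c τ) :=
  mfderiv (𝓘(ℝ, E).prod 𝓘(ℝ, ℝ)) 𝓘(ℝ, E') (fun q : G × ℝ => s q.1 * c q.2) (g, τ) (v, r)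

end CentralExtension

end Extension

end MagneticLie

end

/-! The central tool is a fibre coordinate. Near `s g` the map `(g, τ) ↦ s g * c τ` is a local
diffeomorphism, so every nearby `h` is `s (π h) * c (τ h)` with a smooth real function `τ`
(`exists_fibre_coordinate`). A character with derivative `-1` along `Z` satisfies `χ (c τ) = exp
(-τ)` near `0`, hence near `s g * t` the function `U` is `χ t * exp (-τ (h * t⁻¹))`. Its logarithmic
derivative forgets the constant `χ t`, and right-invariant fields do not notice right translation by
`t`. So `U⁻¹ η̃_X U = -η̃_X τ (s g)` for all `t` (`logDeriv_fibreFun_mul`).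

The potential pulled back by `π` therefore equals `-η̃_X τ` on a whole neighbourhood of `s g`. Since
`dπ` carries `η̃_X` to `η_X`, this gives `η_X A(Y) = -η̃_X η̃_Y τ`. The commutator of the lifted
fields is `η̃` of `[X, Y] + B(X, Y) Z`, and `η̃_Z τ = -1`. What remains of `δA(X, Y)` is `B(X, Y)`
(`coboundaryOne_potential`). Adding `δφ` changes nothing because `δδ = 0`.

Conversely, the difference of two solutions is a closed cochain. In a chart it is a closed 1-form,
since the right-invariant fields form a frame whose brackets are those of the Lie algebra
(`lieBracket_chartFrame`). The Poincaré lemma on a ball gives local primitives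
(`exists_local_primitive`). They differ by locally constant functions, and on a simply connected set
they can be glued through a covering space (`exists_glue_of_locally_const`).

In the coordinates `(g, τ)`, right translation by `c τ` is a shift of the second coordinate. So the
coefficient of `∂/∂g⁰` in `η̃_X` is its value at `τ = 0`, which is `η̃_X τ (s g)`, minus the
potential. -/

noncomputable section

namespace MagneticLie

open Set Filter Topology

/-! ### Derivatives on manifolds as maps of model spaces; the inverse function theorem -/

section Calculus

variable {E : Type*} [NormedAddCommGroup E] [NormedSpace ℝ E]
  {H : Type*} [TopologicalSpace H] {I : ModelWithCorners ℝ E H}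
  {M : Type*} [TopologicalSpace M] [ChartedSpace H M]
  {E' : Type*} [NormedAddCommGroup E'] [NormedSpace ℝ E']
  {H' : Type*} [TopologicalSpace H'] {I' : ModelWithCorners ℝ E' H'}
  {M' : Type*} [TopologicalSpace M'] [ChartedSpace H' M']
  {E'' : Type*} [NormedAddCommGroup E''] [NormedSpace ℝ E'']
  {H'' : Type*} [TopologicalSpace H''] {I'' : ModelWithCorners ℝ E'' H''}
  {M'' : Type*} [TopologicalSpace M''] [ChartedSpace H'' M'']

variable (I I') in
/-- The derivative of a map between manifolds, as a linear map between the model spaces. -/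
def modelDeriv (f : M → M') (x : M) : E →L[ℝ] E' := mfderiv I I' f x

theorem modelDeriv_comp {g : M' → M''} {f : M → M'} (x : M)
    (hg : MDifferentiableAt I' I'' g (f x)) (hf : MDifferentiableAt I I' f x) (v : E) :
    modelDeriv I I'' (fun y => g (f y)) x v
      = modelDeriv I' I'' g (f x) (modelDeriv I I' f x v) := by
  have := mfderiv_comp x hg hf
  exact DFunLike.congr_fun (F := E →L[ℝ] E'') this v

theorem modelDeriv_congr {f f' : M → M'} {x : M} (h : f =ᶠ[𝓝 x] f') :
    modelDeriv I I' f x = modelDeriv I I' f' x :=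
  h.mfderiv_eq

theorem modelDeriv_id (x : M) (v : E) : modelDeriv I I (fun y : M => y) x v = v := by
  have := mfderiv_id (I := I) (x := x)
  exact DFunLike.congr_fun (F := E →L[ℝ] E) this v

theorem modelDeriv_const (x : M) (y : M') (v : E) :
    modelDeriv I I' (fun _ : M => y) x v = 0 := by
  have := mfderiv_const (I := I) (I' := I') (x := x) (c := y)
  exact DFunLike.congr_fun (F := E →L[ℝ] E') this v

theorem modelDeriv_eq_fderiv (f : E → E') (x : E) :
    modelDeriv 𝓘(ℝ, E) 𝓘(ℝ, E') f x = fderiv ℝ f x :=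
  mfderiv_eq_fderiv

theorem modelDeriv_prod {f : M × M' → M''} {x : M} {y : M'}
    (hf : MDifferentiableAt (I.prod I') I'' f (x, y)) (u : E) (v : E') :
    modelDeriv (I.prod I') I'' f (x, y) (u, v)
      = modelDeriv I I'' (fun z => f (z, y)) x u + modelDeriv I' I'' (fun z => f (x, z)) y v :=
  mfderiv_prod_eq_add_apply (v := ((u, v) : E × E')) hf

theorem modelDeriv_prodMk {f : M → M'} {g : M → M''} {x : M}
    (hf : MDifferentiableAt I I' f x) (hg : MDifferentiableAt I I'' g x) (v : E) :
    modelDeriv I (I'.prod I'') (fun y => (f y, g y)) x v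
      = (modelDeriv I I' f x v, modelDeriv I I'' g x v) := by
  have := mfderiv_prodMk hf hg
  exact DFunLike.congr_fun (F := E →L[ℝ] E' × E'') this v

theorem modelDeriv_eq_fderiv_writtenInExtChartAt [I.Boundaryless] {f : M → M'} {x : M}
    (hf : MDifferentiableAt I I' f x) :
    modelDeriv I I' f x = fderiv ℝ (writtenInExtChartAt I I' x f) (extChartAt I x x) := by
  have h : modelDeriv I I' f x
      = fderivWithin ℝ (writtenInExtChartAt I I' x f) (range I) (extChartAt I x x) := hf.mfderiv
  rw [h, I.range_eq_univ, fderivWithin_univ]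

/-- The inverse function theorem for a manifold without boundary, giving a smooth local right
inverse. -/
theorem exists_local_right_inverse [I.Boundaryless]
    [IsManifold I ∞ M] [IsManifold I' ∞ M'] [FiniteDimensional ℝ E] [FiniteDimensional ℝ E']
    {f : M → M'} {x : M} (hf : ContMDiffAt I I' ∞ f x)
    (hbij : Function.Bijective (modelDeriv I I' f x)) :
    ∃ k : M' → M, ContMDiffAt I' I ∞ k (f x) ∧ k (f x) = x ∧ ∀ᶠ y in 𝓝 (f x), f (k y) = y := by
  have := FiniteDimensional.complete ℝ E
  have := FiniteDimensional.complete ℝ E'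
  set F : E → E' := writtenInExtChartAt I I' x f with hF
  set a : E := extChartAt I x x with ha
  have hFa : F a = extChartAt I' (f x) (f x) := by simp [hF, ha, writtenInExtChartAt]
  have hFd : ContDiffAt ℝ ∞ F a := by
    have := (contMDiffAt_iff.1 hf).2
    rw [I.range_eq_univ, contDiffWithinAt_univ] at this
    exact this
  have hFdiff : HasFDerivAt F (modelDeriv I I' f x) a := by
    rw [modelDeriv_eq_fderiv_writtenInExtChartAt (hf.mdifferentiableAt (by simp))]
    exact (hFd.differentiableAt (by simp)).hasFDerivAt
  -- The inverse function theorem is applied to `f` read in charts, whose derivative at `a` is the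
  -- derivative of `f`; the result is then carried back through the charts.
  set L : E ≃L[ℝ] E' := ContinuousLinearEquiv.ofBijective (modelDeriv I I' f x)
    (LinearMap.ker_eq_bot.2 hbij.1) (LinearMap.range_eq_top.2 hbij.2)
  have hL : HasFDerivAt F (L : E →L[ℝ] E') a := hFdiff
  have hne : (∞ : WithTop ℕ∞) ≠ 0 := by simp
  set k₀ : E' → E := hFd.localInverse hL hne
  have hk₀ : k₀ (F a) = a := hFd.localInverse_apply_image hL hne
  have hk₀d : ContDiffAt ℝ ∞ k₀ (F a) := hFd.to_localInverse hL hne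
  have hinv : ∀ᶠ z in 𝓝 (F a), F (k₀ z) = z :=
    (hFd.hasStrictFDerivAt' hL hne).eventually_right_inverse
  have hchart : Tendsto (extChartAt I' (f x)) (𝓝 (f x)) (𝓝 (F a)) := by
    rw [hFa]; exact continuousAt_extChartAt (f x)
  have hksmooth : ContMDiffAt I' I ∞ (fun y => (extChartAt I x).symm (k₀ (extChartAt I' (f x) y)))
      (f x) := by
    have h1 : ContMDiffAt 𝓘(ℝ, E) I ∞ (extChartAt I x).symm (k₀ (extChartAt I' (f x) (f x))) := by
      rw [← hFa, hk₀]
      have := contMDiffWithinAt_extChartAt_symm_range (I := I) (n := ∞) x (mem_extChartAt_target x)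
      rwa [I.range_eq_univ, contMDiffWithinAt_univ] at this
    have h2 : ContMDiffAt 𝓘(ℝ, E') 𝓘(ℝ, E) ∞ k₀ (extChartAt I' (f x) (f x)) := by
      rw [← hFa]; exact hk₀d.contMDiffAt
    exact h1.comp (f x) (h2.comp (f x) contMDiffAt_extChartAt)
  have hkx : (extChartAt I x).symm (k₀ (extChartAt I' (f x) (f x))) = x := by
    rw [← hFa, hk₀, ha]; simp
  refine ⟨_, hksmooth, hkx, ?_⟩
  have hcont : ContinuousAt (fun y => f ((extChartAt I x).symm (k₀ (extChartAt I' (f x) y))))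
      (f x) := by
    have h3 := hksmooth.continuousAt
    have h4 : ContinuousAt f ((extChartAt I x).symm (k₀ (extChartAt I' (f x) (f x)))) := by
      rw [hkx]; exact hf.continuousAt
    exact ContinuousAt.comp (g := f) h4 h3
  have hmem : ∀ᶠ y in 𝓝 (f x), f ((extChartAt I x).symm (k₀ (extChartAt I' (f x) y)))
      ∈ (extChartAt I' (f x)).source := by
    apply hcont
    beta_reduce
    rw [hkx]
    exact extChartAt_source_mem_nhds (f x)
  filter_upwards [hmem, hchart.eventually hinv, extChartAt_source_mem_nhds (I := I') (f x)]
    with y h1 h2 h3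
  exact (extChartAt I' (f x)).injOn h1 h3 h2

end Calculus

/-! ### Right-invariant vector fields: translation, homomorphisms, inversion, smoothness -/

section RightVectors

variable {E : Type*} [NormedAddCommGroup E] [NormedSpace ℝ E]
  {G : Type*} [TopologicalSpace G] [ChartedSpace E G] [Group G]

variable (E) in
/-- The right-invariant vector fields at the point `g`, as a linear map on the model space. -/
def rightVec (g : G) : E →L[ℝ] E := -modelDeriv 𝓘(ℝ, E) 𝓘(ℝ, E) (fun h : G => h * g) 1

theorem rightVec_apply (g : G) (X : E) :
    rightVec E g X = -modelDeriv 𝓘(ℝ, E) 𝓘(ℝ, E) (fun h : G => h * g) 1 X := rfl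

theorem rightDeriv_eq_modelDeriv (X : GroupLieAlgebra 𝓘(ℝ, E) G) (f : G → ℝ) (g : G) :
    rightDeriv X f g = modelDeriv 𝓘(ℝ, E) 𝓘(ℝ, ℝ) f g (rightVec E g X) := rfl

variable [LieGroup 𝓘(ℝ, E) ∞ G]
  {E' : Type*} [NormedAddCommGroup E'] [NormedSpace ℝ E']
  {G' : Type*} [TopologicalSpace G'] [ChartedSpace E' G'] [Group G'] [LieGroup 𝓘(ℝ, E') ∞ G']

theorem mdifferentiable_mul_right (k : G) :
    MDifferentiable 𝓘(ℝ, E) 𝓘(ℝ, E) (fun h : G => h * k) :=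
  (contMDiff_mul_right (n := ∞)).mdifferentiable (by simp)

theorem mdifferentiable_mul_left (k : G) :
    MDifferentiable 𝓘(ℝ, E) 𝓘(ℝ, E) (fun h : G => k * h) :=
  (contMDiff_mul_left (n := ∞)).mdifferentiable (by simp)

theorem mdifferentiable_inv : MDifferentiable 𝓘(ℝ, E) 𝓘(ℝ, E) (fun h : G => h⁻¹) :=
  (contMDiff_inv 𝓘(ℝ, E) ∞).mdifferentiable (by simp)

theorem modelDeriv_mul_right_rightVec (X : E) (g k : G) :
    modelDeriv 𝓘(ℝ, E) 𝓘(ℝ, E) (fun h : G => h * k) g (rightVec E g X) = rightVec E (g * k) X := by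
  have h := modelDeriv_comp (g := fun h : G => h * k) (f := fun h : G => h * g) 1
    (mdifferentiable_mul_right (E := E) k _) (mdifferentiable_mul_right (E := E) g _) X
  simp only [one_mul, mul_assoc] at h
  rw [rightVec_apply, rightVec_apply, map_neg, ← h]

theorem modelDeriv_hom_rightVec (φ : G' →* G) (hφ : MDifferentiable 𝓘(ℝ, E') 𝓘(ℝ, E) φ)
    (X : E') (h : G') :
    modelDeriv 𝓘(ℝ, E') 𝓘(ℝ, E) φ h (rightVec E' h X)
      = rightVec E (φ h) (modelDeriv 𝓘(ℝ, E') 𝓘(ℝ, E) φ 1 X) := by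
  have h1 := modelDeriv_comp (g := φ) (f := fun k : G' => k * h) 1
    (hφ _) (mdifferentiable_mul_right (E := E') h _) X
  have h2 := modelDeriv_comp (g := fun k : G => k * φ h) (f := φ) 1
    (mdifferentiable_mul_right (E := E) (φ h) _) (hφ _) X
  simp only [one_mul, map_mul, map_one] at h1 h2
  rw [rightVec_apply, rightVec_apply, map_neg, ← h1, h2]

/-- Differentiating `h * h⁻¹ = 1` at the identity, the two partial derivatives of the product add up
to zero. -/
theorem modelDeriv_inv_one (X : E) :
    modelDeriv 𝓘(ℝ, E) 𝓘(ℝ, E) (fun h : G => h⁻¹) 1 X = -X := by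
  have hm : MDifferentiableAt (𝓘(ℝ, E).prod 𝓘(ℝ, E)) 𝓘(ℝ, E) (fun p : G × G => p.1 * p.2)
      ((1 : G), (1 : G)⁻¹) := (contMDiff_mul 𝓘(ℝ, E) ∞).mdifferentiable (by simp) _
  have h1 := modelDeriv_comp (I := 𝓘(ℝ, E)) (I' := 𝓘(ℝ, E).prod 𝓘(ℝ, E)) (I'' := 𝓘(ℝ, E))
    (g := fun p : G × G => p.1 * p.2) (f := fun h : G => (h, h⁻¹)) 1 hm
    (mdifferentiableAt_id.prodMk (mdifferentiable_inv _)) X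
  rw [modelDeriv_prodMk (I := 𝓘(ℝ, E)) (I' := 𝓘(ℝ, E)) (I'' := 𝓘(ℝ, E)) (f := fun h : G => h)
    mdifferentiableAt_id (mdifferentiable_inv _), modelDeriv_prod hm] at h1
  simp only [mul_inv_cancel, inv_one, mul_one, one_mul, modelDeriv_id, modelDeriv_const] at h1
  exact eq_neg_of_add_eq_zero_right h1.symm

/-- Because `(h * g)⁻¹ = g⁻¹ * h⁻¹`, inversion turns `η_X` into the left-invariant field of `X`: the
sign in `η_X` cancels that of the derivative of inversion. This is what makes the brackets come out
without a sign. -/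
theorem modelDeriv_inv_rightVec (X : E) (g : G) :
    modelDeriv 𝓘(ℝ, E) 𝓘(ℝ, E) (fun h : G => h⁻¹) g (rightVec E g X)
      = modelDeriv 𝓘(ℝ, E) 𝓘(ℝ, E) (fun h : G => g⁻¹ * h) 1 X := by
  have h1 := modelDeriv_comp (g := fun h : G => h⁻¹) (f := fun h : G => h * g) 1
    (mdifferentiable_inv (E := E) _) (mdifferentiable_mul_right (E := E) g _) X
  have h2 := modelDeriv_comp (g := fun h : G => g⁻¹ * h) (f := fun h : G => h⁻¹) 1
    (mdifferentiable_mul_left (E := E) g⁻¹ _) (mdifferentiable_inv (E := E) _) X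
  rw [modelDeriv_inv_one, map_neg] at h2
  simp only [mul_inv_rev, one_mul, inv_one] at h1 h2
  rw [rightVec_apply, map_neg, ← h1, h2, neg_neg]

theorem rightVec_bijective (g : G) : Function.Bijective (rightVec E g) := by
  have key (h : G) (v : E) :
      modelDeriv 𝓘(ℝ, E) 𝓘(ℝ, E) (fun k : G => k * h⁻¹) h (rightVec E h v) = -v := by
    rw [modelDeriv_mul_right_rightVec, mul_inv_cancel, rightVec_apply]
    simp only [mul_one, modelDeriv_id]
  refine ⟨fun u v huv => ?_, fun v => ?_⟩
  · have := key g u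
    rw [huv, key g v] at this
    exact (neg_injective this).symm
  · refine ⟨-modelDeriv 𝓘(ℝ, E) 𝓘(ℝ, E) (fun h : G => h * g⁻¹) g v, ?_⟩
    have h := modelDeriv_comp (g := fun h : G => h * g) (f := fun h : G => h * g⁻¹) g
      (mdifferentiable_mul_right (E := E) g _) (mdifferentiable_mul_right (E := E) g⁻¹ _) v
    simp only [mul_inv_cancel, inv_mul_cancel_right, modelDeriv_id] at h
    rw [rightVec_apply, map_neg, neg_neg, ← h]

theorem contMDiffAt_extChartAt_symm_self {M : Type*} [TopologicalSpace M] [ChartedSpace E M]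
    [IsManifold 𝓘(ℝ, E) ∞ M] (x : M) {y : E} (hy : y ∈ (extChartAt 𝓘(ℝ, E) x).target) :
    ContMDiffAt 𝓘(ℝ, E) 𝓘(ℝ, E) ∞ (extChartAt 𝓘(ℝ, E) x).symm y := by
  have := contMDiffWithinAt_extChartAt_symm_range (I := 𝓘(ℝ, E)) (n := ∞) x hy
  rwa [ModelWithCorners.range_eq_univ, contMDiffWithinAt_univ] at this

/-- With `ψ` the chart at `1`, `η_X f` at `h` is, up to sign, a partial derivative in `z` at the
fixed point `ψ 1` of the jointly smooth function `f (ψ⁻¹ z * h)`. A partial derivative of a jointly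
smooth function depends smoothly on the parameter `h`. -/
theorem contMDiffAt_modelDeriv_rightVec {F : Type*} [NormedAddCommGroup F] [NormedSpace ℝ F]
    {f : G → F} {g : G} (hf : ContMDiffAt 𝓘(ℝ, E) 𝓘(ℝ, F) ∞ f g) (X : E) :
    ContMDiffAt 𝓘(ℝ, E) 𝓘(ℝ, F) ∞
      (fun h => modelDeriv 𝓘(ℝ, E) 𝓘(ℝ, F) f h (rightVec E h X)) g := by
  set ψ := extChartAt 𝓘(ℝ, E) (1 : G) with hψ
  have hψ1 : ψ.symm (ψ 1) = 1 := by simp [hψ]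
  have hs : ContMDiffAt 𝓘(ℝ, E) 𝓘(ℝ, E) ∞ ψ.symm (ψ 1) :=
    contMDiffAt_extChartAt_symm_self 1 (mem_extChartAt_target (1 : G))
  have hK : ContMDiffAt (𝓘(ℝ, E).prod 𝓘(ℝ, E)) 𝓘(ℝ, F) ∞
      (Function.uncurry fun (h : G) (z : E) => f (ψ.symm z * h)) (g, ψ 1) := by
    have h1 : ContMDiffAt 𝓘(ℝ, E) 𝓘(ℝ, F) ∞ f (ψ.symm (ψ 1) * g) := by rwa [hψ1, one_mul]
    have h2 : ContMDiffAt (𝓘(ℝ, E).prod 𝓘(ℝ, E)) 𝓘(ℝ, E) ∞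
        (fun p : G × E => ψ.symm p.2 * p.1) (g, ψ 1) :=
      (ContMDiffAt.comp (g := ψ.symm) (f := Prod.snd) (g, ψ 1) hs contMDiffAt_snd).mul
        contMDiffAt_fst
    exact ContMDiffAt.comp (g := f) (f := fun p : G × E => ψ.symm p.2 * p.1) (g, ψ 1) h1 h2
  have hD : ContMDiffAt 𝓘(ℝ, E) 𝓘(ℝ, E →L[ℝ] F) ∞
      (fun h : G => modelDeriv 𝓘(ℝ, E) 𝓘(ℝ, F) (fun z : E => f (ψ.symm z * h)) (ψ 1)) g := by
    have := hK.mfderiv (fun (h : G) (z : E) => f (ψ.symm z * h)) (fun _ => ψ 1)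
      (m := ∞) contMDiffAt_const (by simp)
    erw [inTangentCoordinates_model_space] at this
    exact this
  set X₁ : E := modelDeriv 𝓘(ℝ, E) 𝓘(ℝ, E) ψ (1 : G) X with hX₁
  have hX : modelDeriv 𝓘(ℝ, E) 𝓘(ℝ, E) ψ.symm (ψ 1) X₁ = X := by
    have h1 := modelDeriv_comp (g := ψ.symm) (f := ψ) (1 : G) (hs.mdifferentiableAt (by simp))
      (mdifferentiableAt_extChartAt (mem_chart_source E (1 : G))) X
    have h2 : (fun y => ψ.symm (ψ y)) =ᶠ[𝓝 (1 : G)] fun y => y := by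
      filter_upwards [extChartAt_source_mem_nhds (I := 𝓘(ℝ, E)) (1 : G)] with y hy
      exact ψ.left_inv hy
    rw [modelDeriv_congr h2, modelDeriv_id] at h1
    exact h1.symm
  have hD' : ContMDiffAt 𝓘(ℝ, E) 𝓘(ℝ, F) ∞ (fun h : G =>
      -modelDeriv 𝓘(ℝ, E) 𝓘(ℝ, F) (fun z : E => f (ψ.symm z * h)) (ψ 1) X₁) g :=
    (hD.clm_apply (contMDiffAt_const (c := X₁))).neg
  refine hD'.congr_of_eventuallyEq ?_
  -- Being `C^∞` at a point is not an open condition (the neighbourhood may shrink with the order),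
  -- so the passage to nearby points is made at order `1`.
  filter_upwards [(contMDiffAt_iff_contMDiffAt_nhds (n := 1) (by simp)).1 (hf.of_le (by simp))] with h hh
  have hh' : MDifferentiableAt 𝓘(ℝ, E) 𝓘(ℝ, F) f (ψ.symm (ψ 1) * h) := by
    rw [hψ1, one_mul]; exact hh.mdifferentiableAt (by simp)
  have hc : MDifferentiableAt 𝓘(ℝ, E) 𝓘(ℝ, F) (fun k : G => f (k * h)) (ψ.symm (ψ 1)) :=
    MDifferentiableAt.comp (g := f) (f := fun k : G => k * h) _ hh'
      (mdifferentiable_mul_right (E := E) h _)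
  have h1 := modelDeriv_comp (I := 𝓘(ℝ, E)) (g := fun k : G => f (k * h)) (f := ψ.symm) (ψ 1) hc
    (hs.mdifferentiableAt (by simp)) X₁
  have h2 := modelDeriv_comp (g := f) (f := fun k : G => k * h) (ψ.symm (ψ 1))
    hh' (mdifferentiable_mul_right (E := E) h _) X
  rw [hX, h2, hψ1, one_mul] at h1
  rw [h1, rightVec_apply, map_neg]

end RightVectors

/-! ### The right-invariant frame in a chart and its Lie brackets -/

section ChartFrame

variable {E : Type*} [NormedAddCommGroup E] [NormedSpace ℝ E]
  {G : Type*} [TopologicalSpace G] [ChartedSpace E G] [Group G]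

/-- The right-invariant vector fields in the chart at `g₀`. -/
def chartFrame (g₀ : G) (y : E) : E →L[ℝ] E :=
  (modelDeriv 𝓘(ℝ, E) 𝓘(ℝ, E) (extChartAt 𝓘(ℝ, E) g₀) ((extChartAt 𝓘(ℝ, E) g₀).symm y)).comp
    (rightVec E ((extChartAt 𝓘(ℝ, E) g₀).symm y))

section Chart

variable {M : Type*} [TopologicalSpace M] [ChartedSpace E M]

theorem eventually_extChartAt_right_inv {x : M} {y : E}
    (hy : y ∈ (extChartAt 𝓘(ℝ, E) x).target) :
    ∀ᶠ z in 𝓝 y, extChartAt 𝓘(ℝ, E) x ((extChartAt 𝓘(ℝ, E) x).symm z) = z := by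
  filter_upwards [(isOpen_extChartAt_target (I := 𝓘(ℝ, E)) x).mem_nhds hy] with z hz
  exact (extChartAt 𝓘(ℝ, E) x).right_inv hz

theorem eventually_extChartAt_left_inv {x y : M} (hy : y ∈ (extChartAt 𝓘(ℝ, E) x).source) :
    ∀ᶠ z in 𝓝 y, (extChartAt 𝓘(ℝ, E) x).symm (extChartAt 𝓘(ℝ, E) x z) = z := by
  filter_upwards [(isOpen_extChartAt_source (I := 𝓘(ℝ, E)) x).mem_nhds hy] with z hz
  exact (extChartAt 𝓘(ℝ, E) x).left_inv hz

variable [IsManifold 𝓘(ℝ, E) ∞ M]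

theorem mdifferentiableAt_extChartAt_symm_apply {x : M} {y : E}
    (hy : y ∈ (extChartAt 𝓘(ℝ, E) x).target) :
    MDifferentiableAt 𝓘(ℝ, E) 𝓘(ℝ, E) (extChartAt 𝓘(ℝ, E) x) ((extChartAt 𝓘(ℝ, E) x).symm y) := by
  have : IsManifold 𝓘(ℝ, E) 1 M := IsManifold.of_le (n := ∞) (by simp)
  refine mdifferentiableAt_extChartAt ?_
  rw [← extChartAt_source 𝓘(ℝ, E)]
  exact (extChartAt 𝓘(ℝ, E) x).map_target hy

theorem modelDeriv_extChartAt_modelDeriv_symm {x : M} {y : E}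
    (hy : y ∈ (extChartAt 𝓘(ℝ, E) x).target) (v : E) :
    modelDeriv 𝓘(ℝ, E) 𝓘(ℝ, E) (extChartAt 𝓘(ℝ, E) x) ((extChartAt 𝓘(ℝ, E) x).symm y)
      (modelDeriv 𝓘(ℝ, E) 𝓘(ℝ, E) (extChartAt 𝓘(ℝ, E) x).symm y v) = v := by
  rw [← modelDeriv_comp y (mdifferentiableAt_extChartAt_symm_apply hy)
    ((contMDiffAt_extChartAt_symm_self x hy).mdifferentiableAt (by simp)),
    modelDeriv_congr (eventually_extChartAt_right_inv hy), modelDeriv_id]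

theorem modelDeriv_symm_modelDeriv_extChartAt {x : M} {y : E}
    (hy : y ∈ (extChartAt 𝓘(ℝ, E) x).target) (v : E) :
    modelDeriv 𝓘(ℝ, E) 𝓘(ℝ, E) (extChartAt 𝓘(ℝ, E) x).symm y
      (modelDeriv 𝓘(ℝ, E) 𝓘(ℝ, E) (extChartAt 𝓘(ℝ, E) x) ((extChartAt 𝓘(ℝ, E) x).symm y) v)
      = v := by
  have hr := (extChartAt 𝓘(ℝ, E) x).right_inv hy
  have hs : MDifferentiableAt 𝓘(ℝ, E) 𝓘(ℝ, E) (extChartAt 𝓘(ℝ, E) x).symm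
      (extChartAt 𝓘(ℝ, E) x ((extChartAt 𝓘(ℝ, E) x).symm y)) := by
    rw [hr]
    exact (contMDiffAt_extChartAt_symm_self x hy).mdifferentiableAt (by simp)
  have h := modelDeriv_comp _ hs (mdifferentiableAt_extChartAt_symm_apply hy) v
  rw [hr] at h
  rw [← h, modelDeriv_congr (eventually_extChartAt_left_inv
    ((extChartAt 𝓘(ℝ, E) x).map_target hy)), modelDeriv_id]

end Chart

variable [LieGroup 𝓘(ℝ, E) ∞ G]

theorem modelDeriv_symm_chartFrame {g₀ : G} {y : E} (hy : y ∈ (extChartAt 𝓘(ℝ, E) g₀).target)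
    (X : E) :
    modelDeriv 𝓘(ℝ, E) 𝓘(ℝ, E) (extChartAt 𝓘(ℝ, E) g₀).symm y (chartFrame g₀ y X)
      = rightVec E ((extChartAt 𝓘(ℝ, E) g₀).symm y) X :=
  modelDeriv_symm_modelDeriv_extChartAt hy _

theorem chartFrame_bijective {g₀ : G} {y : E} (hy : y ∈ (extChartAt 𝓘(ℝ, E) g₀).target) :
    Function.Bijective (chartFrame g₀ y) := by
  refine Function.Bijective.comp (f := rightVec E ((extChartAt 𝓘(ℝ, E) g₀).symm y))
    (g := modelDeriv 𝓘(ℝ, E) 𝓘(ℝ, E) (extChartAt 𝓘(ℝ, E) g₀) ((extChartAt 𝓘(ℝ, E) g₀).symm y))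
    ⟨fun u v huv => ?_, fun v => ⟨_, modelDeriv_extChartAt_modelDeriv_symm hy v⟩⟩
    (rightVec_bijective _)
  rw [← modelDeriv_symm_modelDeriv_extChartAt hy u, huv, modelDeriv_symm_modelDeriv_extChartAt hy v]

theorem modelDeriv_rightVec_eq_fderiv {F : Type*} [NormedAddCommGroup F] [NormedSpace ℝ F]
    {g₀ : G} {y : E} (hy : y ∈ (extChartAt 𝓘(ℝ, E) g₀).target) {f : G → F}
    (hf : MDifferentiableAt 𝓘(ℝ, E) 𝓘(ℝ, F) f ((extChartAt 𝓘(ℝ, E) g₀).symm y)) (X : E) :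
    modelDeriv 𝓘(ℝ, E) 𝓘(ℝ, F) f ((extChartAt 𝓘(ℝ, E) g₀).symm y)
        (rightVec E ((extChartAt 𝓘(ℝ, E) g₀).symm y) X)
      = fderiv ℝ (fun z => f ((extChartAt 𝓘(ℝ, E) g₀).symm z)) y (chartFrame g₀ y X) := by
  rw [← modelDeriv_symm_chartFrame hy, ← modelDeriv_eq_fderiv,
    modelDeriv_comp y hf ((contMDiffAt_extChartAt_symm_self g₀ hy).mdifferentiableAt (by simp))]

theorem contDiffAt_comp_extChartAt_symm {F : Type*} [NormedAddCommGroup F] [NormedSpace ℝ F]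
    {g₀ : G} {y : E} (hy : y ∈ (extChartAt 𝓘(ℝ, E) g₀).target) {f : G → F}
    (hf : ContMDiffAt 𝓘(ℝ, E) 𝓘(ℝ, F) ∞ f ((extChartAt 𝓘(ℝ, E) g₀).symm y)) :
    ContDiffAt ℝ ∞ (fun z => f ((extChartAt 𝓘(ℝ, E) g₀).symm z)) y :=
  (ContMDiffAt.comp y hf (contMDiffAt_extChartAt_symm_self g₀ hy)).contDiffAt

theorem contDiffAt_chartFrame_apply {g₀ : G} {y : E} (hy : y ∈ (extChartAt 𝓘(ℝ, E) g₀).target)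
    (X : E) : ContDiffAt ℝ ∞ (fun z => chartFrame g₀ z X) y := by
  refine contDiffAt_comp_extChartAt_symm hy
    (f := fun h => modelDeriv 𝓘(ℝ, E) 𝓘(ℝ, E) (extChartAt 𝓘(ℝ, E) g₀) h (rightVec E h X)) ?_
  refine contMDiffAt_modelDeriv_rightVec ?_ X
  refine contMDiffAt_extChartAt' ?_
  rw [← extChartAt_source 𝓘(ℝ, E)]
  exact (extChartAt 𝓘(ℝ, E) g₀).map_target hy

theorem contDiffAt_chartFrame [FiniteDimensional ℝ E] {g₀ : G} {y : E}
    (hy : y ∈ (extChartAt 𝓘(ℝ, E) g₀).target) : ContDiffAt ℝ ∞ (chartFrame g₀) y :=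
  (contDiffOn_clm_apply.2 fun X _ hz =>
    (contDiffAt_chartFrame_apply hz X).contDiffWithinAt).contDiffAt
    ((isOpen_extChartAt_target (I := 𝓘(ℝ, E)) g₀).mem_nhds hy)

/-- The frame is the pull-back of the left-invariant fields under `z ↦ (ψ⁻¹ z)⁻¹`, the inverse chart
followed by inversion. Pull-back respects brackets, and the bracket of the Lie algebra is defined by
left-invariant fields. -/
theorem lieBracket_chartFrame [CompleteSpace E] {g₀ : G} {y : E}
    (hy : y ∈ (extChartAt 𝓘(ℝ, E) g₀).target) (X Y : GroupLieAlgebra 𝓘(ℝ, E) G) :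
    VectorField.lieBracket ℝ (fun z => chartFrame (E := E) g₀ z X)
        (fun z => chartFrame (E := E) g₀ z Y) y
      = chartFrame (E := E) g₀ y (⁅X, Y⁆ : GroupLieAlgebra 𝓘(ℝ, E) G) := by
  have : LieGroup 𝓘(ℝ, E) (minSmoothness ℝ 3) G := 
    LieGroup.of_le (n := ∞) (by
      rw [minSmoothness_of_isRCLikeNormedField]
      exact ENat.LEInfty.out)
  set ψ := extChartAt 𝓘(ℝ, E) g₀ with hψ
  set m : E → G := fun z => (ψ.symm z)⁻¹ with hm
  have hmC {z : E} (hz : z ∈ ψ.target) : ContMDiffAt 𝓘(ℝ, E) 𝓘(ℝ, E) ∞ m z :=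
    (contMDiffAt_extChartAt_symm_self g₀ hz).inv
  have hpull {z : E} (hz : z ∈ ψ.target) (W : GroupLieAlgebra 𝓘(ℝ, E) G) :
      VectorField.mpullback 𝓘(ℝ, E) 𝓘(ℝ, E) m (mulInvariantVectorField W) z
        = chartFrame (E := E) g₀ z W := by
    set n : G → E := fun h => ψ h⁻¹ with hn
    have hnd : MDifferentiableAt 𝓘(ℝ, E) 𝓘(ℝ, E) n (m z) := by
      refine MDifferentiableAt.comp (g := ψ) (f := fun h : G => h⁻¹) _ ?_
        (mdifferentiable_inv (E := E) _)
      simp only [hm, inv_inv]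
      exact mdifferentiableAt_extChartAt_symm_apply hz
    have hmd := (hmC hz).mdifferentiableAt (by simp)
    have hnm : ∀ᶠ w in 𝓝 z, n (m w) = w := by
      filter_upwards [eventually_extChartAt_right_inv hz] with w hw
      simp only [hn, hm, inv_inv]
      exact hw
    have hnz : n (m z) = z := hnm.self_of_nhds
    have hmn : ∀ᶠ h in 𝓝 (m z), m (n h) = h := by
      have h1 : Tendsto (fun h : G => h⁻¹) (𝓝 (m z)) (𝓝 (ψ.symm z)) := by
        have := (contMDiff_inv 𝓘(ℝ, E) ∞ (G := G)).continuous.continuousAt (x := m z)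
        simpa [ContinuousAt, hm] using this
      filter_upwards [h1.eventually (eventually_extChartAt_left_inv (ψ.map_target hz))] with h hh
      simp only [hn, hm, hψ, hh, inv_inv]
    -- The pull-back is defined through the inverse of the derivative of `m`; it is identified as
    -- the derivative of the local inverse map `n`.
    have hinv : ContinuousLinearMap.inverse (modelDeriv 𝓘(ℝ, E) 𝓘(ℝ, E) m z)
        = modelDeriv 𝓘(ℝ, E) 𝓘(ℝ, E) n (m z) := by
      refine ContinuousLinearMap.inverse_eq ?_ ?_
      · ext v
        have hmd' : MDifferentiableAt 𝓘(ℝ, E) 𝓘(ℝ, E) m (n (m z)) := by rwa [hnz]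
        have := modelDeriv_comp (m z) hmd' hnd v
        rw [modelDeriv_congr hmn, modelDeriv_id, hnz] at this
        exact this.symm
      · ext v
        have := modelDeriv_comp z hnd hmd v
        rw [modelDeriv_congr hnm, modelDeriv_id] at this
        exact this.symm
    have h1 : VectorField.mpullback 𝓘(ℝ, E) 𝓘(ℝ, E) m (mulInvariantVectorField W) z
        = ContinuousLinearMap.inverse (modelDeriv 𝓘(ℝ, E) 𝓘(ℝ, E) m z)
          (modelDeriv 𝓘(ℝ, E) 𝓘(ℝ, E) (fun h : G => m z * h) 1 W) := rfl
    rw [h1, hinv]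
    have h2 := modelDeriv_inv_rightVec (E := E) W (ψ.symm z)
    have h3 := modelDeriv_comp (ψ.symm z) (g := n) (f := fun h : G => h⁻¹) hnd
      (mdifferentiable_inv (E := E) _) (rightVec E (ψ.symm z) W)
    rw [h2] at h3
    simp only [hn, inv_inv] at h3
    exact h3.symm
  have key := VectorField.mpullback_mlieBracket (I := 𝓘(ℝ, E)) (I' := 𝓘(ℝ, E)) (f := m) (x₀ := y)
    (n := ∞) (mdifferentiableAt_mulInvariantVectorField X)
    (mdifferentiableAt_mulInvariantVectorField Y) (hmC hy) (by
      rw [minSmoothness_of_isRCLikeNormedField]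
      exact ENat.LEInfty.out)
  rw [← mulInvariantVector_mlieBracket, ← GroupLieAlgebra.bracket_def,
    ← VectorField.mlieBracketWithin_univ, VectorField.mlieBracketWithin_eq_lieBracketWithin] at key
  have key' := (hpull hy ⁅X, Y⁆).symm.trans key
  refine Eq.trans ?_ key'.symm
  have hev (W : GroupLieAlgebra 𝓘(ℝ, E) G) : (fun z => chartFrame (E := E) g₀ z W) =ᶠ[𝓝 y]
      VectorField.mpullback 𝓘(ℝ, E) 𝓘(ℝ, E) m (mulInvariantVectorField W) := by
    filter_upwards [(isOpen_extChartAt_target (I := 𝓘(ℝ, E)) g₀).mem_nhds hy] with z hz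
    exact (hpull hz W).symm
  exact ((hev X).lieBracket_vectorField_eq (hev Y)).trans
    (congrFun VectorField.lieBracketWithin_univ y).symm

end ChartFrame

/-! ### Commutators of right-invariant derivatives and the local Poincaré lemma -/

section RightDerivatives

variable {E : Type*} [NormedAddCommGroup E] [NormedSpace ℝ E]
  {G : Type*} [TopologicalSpace G] [ChartedSpace E G] [Group G] [LieGroup 𝓘(ℝ, E) ∞ G]

theorem contMDiffAt_rightDeriv {f : G → ℝ} {g : G} (hf : ContMDiffAt 𝓘(ℝ, E) 𝓘(ℝ, ℝ) ∞ f g)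
    (X : GroupLieAlgebra 𝓘(ℝ, E) G) : ContMDiffAt 𝓘(ℝ, E) 𝓘(ℝ, ℝ) ∞ (rightDeriv X f) g :=
  contMDiffAt_modelDeriv_rightVec (E := E) hf X

theorem eventually_mdifferentiableAt {f : G → ℝ} {g : G}
    (hf : ContMDiffAt 𝓘(ℝ, E) 𝓘(ℝ, ℝ) ∞ f g) :
    ∀ᶠ h in 𝓝 g, MDifferentiableAt 𝓘(ℝ, E) 𝓘(ℝ, ℝ) f h := by
  filter_upwards [(contMDiffAt_iff_contMDiffAt_nhds (n := 1) (by simp)).1 (hf.of_le (by simp))]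
    with h hh
  exact hh.mdifferentiableAt (by simp)

/-- The product rule in a chart: a Hessian term plus the derivative of the frame. On
antisymmetrizing, the symmetric Hessian drops out and the frame terms form a Lie bracket. -/
theorem rightDeriv_rightDeriv_eq_fderiv {f : G → ℝ} {g : G}
    (hf : ContMDiffAt 𝓘(ℝ, E) 𝓘(ℝ, ℝ) ∞ f g) (X Y : GroupLieAlgebra 𝓘(ℝ, E) G) :
    rightDeriv X (rightDeriv Y f) g
      = fderiv ℝ (fderiv ℝ fun z => f ((extChartAt 𝓘(ℝ, E) g).symm z)) (extChartAt 𝓘(ℝ, E) g g)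
          (chartFrame (E := E) g (extChartAt 𝓘(ℝ, E) g g) X)
          (chartFrame (E := E) g (extChartAt 𝓘(ℝ, E) g g) Y)
        + fderiv ℝ (fun z => f ((extChartAt 𝓘(ℝ, E) g).symm z)) (extChartAt 𝓘(ℝ, E) g g)
          (fderiv ℝ (fun z => chartFrame (E := E) g z Y) (extChartAt 𝓘(ℝ, E) g g)
            (chartFrame (E := E) g (extChartAt 𝓘(ℝ, E) g g) X)) := by
  set ψ := extChartAt 𝓘(ℝ, E) g with hψ
  set f₁ : E → ℝ := fun z => f (ψ.symm z) with hf₁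
  have hy : ψ g ∈ ψ.target := mem_extChartAt_target g
  have hg : ψ.symm (ψ g) = g := extChartAt_to_inv g
  have hf' : ContMDiffAt 𝓘(ℝ, E) 𝓘(ℝ, ℝ) ∞ f (ψ.symm (ψ g)) := by rwa [hg]
  have hf₁c : ContDiffAt ℝ ∞ f₁ (ψ g) := contDiffAt_comp_extChartAt_symm hy hf'
  have hcont : Tendsto ψ.symm (𝓝 (ψ g)) (𝓝 g) := by
    have := (contMDiffAt_extChartAt_symm_self g hy).continuousAt
    rwa [ContinuousAt, ← hψ, hg] at this
  have hev : (fun z => rightDeriv Y f (ψ.symm z)) =ᶠ[𝓝 (ψ g)]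
      fun z => fderiv ℝ f₁ z (chartFrame (E := E) g z Y) := by
    filter_upwards [hcont.eventually (eventually_mdifferentiableAt hf),
      (isOpen_extChartAt_target (I := 𝓘(ℝ, E)) g).mem_nhds hy] with z hz hz'
    exact modelDeriv_rightVec_eq_fderiv (E := E) hz' hz Y
  have h1 := modelDeriv_rightVec_eq_fderiv (E := E) hy (f := rightDeriv Y f)
    ((contMDiffAt_rightDeriv hf' Y).mdifferentiableAt (by simp)) X
  rw [← hψ, hg, hev.fderiv_eq] at h1
  have hd1 : DifferentiableAt ℝ (fderiv ℝ f₁) (ψ g) :=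
    (hf₁c.fderiv_right (m := ∞) (by simp)).differentiableAt (by simp)
  have hd2 : DifferentiableAt ℝ (fun z => chartFrame (E := E) g z Y) (ψ g) :=
    (contDiffAt_chartFrame_apply hy Y).differentiableAt (by simp)
  have h2 : fderiv ℝ (fun z => fderiv ℝ f₁ z (chartFrame (E := E) g z Y)) (ψ g)
      = _ := fderiv_clm_apply hd1 hd2
  rw [h2] at h1
  rw [rightDeriv_eq_modelDeriv, h1, add_comm]
  rfl

theorem rightDeriv_commutator [CompleteSpace E] {f : G → ℝ} {g : G}
    (hf : ContMDiffAt 𝓘(ℝ, E) 𝓘(ℝ, ℝ) ∞ f g) (X Y : GroupLieAlgebra 𝓘(ℝ, E) G) :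
    rightDeriv X (rightDeriv Y f) g - rightDeriv Y (rightDeriv X f) g = rightDeriv ⁅X, Y⁆ f g := by
  have hy := mem_extChartAt_target (I := 𝓘(ℝ, E)) g
  have hg : (extChartAt 𝓘(ℝ, E) g).symm (extChartAt 𝓘(ℝ, E) g g) = g := extChartAt_to_inv g
  have hf' : ContMDiffAt 𝓘(ℝ, E) 𝓘(ℝ, ℝ) ∞ f
      ((extChartAt 𝓘(ℝ, E) g).symm (extChartAt 𝓘(ℝ, E) g g)) := by rwa [hg]
  have hsymm := (contDiffAt_comp_extChartAt_symm hy hf').isSymmSndFDerivAt (by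
      rw [minSmoothness_of_isRCLikeNormedField]
      exact ENat.LEInfty.out)
  have h1 := modelDeriv_rightVec_eq_fderiv (E := E) hy (hf'.mdifferentiableAt (by simp))
    (⁅X, Y⁆ : GroupLieAlgebra 𝓘(ℝ, E) G)
  rw [← lieBracket_chartFrame hy X Y, VectorField.lieBracket_eq, hg] at h1
  rw [rightDeriv_rightDeriv_eq_fderiv hf, rightDeriv_rightDeriv_eq_fderiv hf, rightDeriv_eq_modelDeriv,
    h1, hsymm.eq, map_sub]
  ring

/-- The right-invariant fields span every tangent space, so the full derivative of `f` in a chart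
vanishes on a ball. -/
theorem eventually_eq_of_rightDeriv_eq_zero {U : Set G} (hU : IsOpen U) {f : G → ℝ}
    (hf : IsSmoothOn (E := E) U f)
    (h0 : ∀ (X : GroupLieAlgebra 𝓘(ℝ, E) G), ∀ g ∈ U, rightDeriv X f g = 0) {g₀ : G} (hg₀ : g₀ ∈ U) :
    ∀ᶠ g in 𝓝 g₀, f g = f g₀ := by
  set ψ := extChartAt 𝓘(ℝ, E) g₀ with hψ
  have hy : ψ g₀ ∈ ψ.target := mem_extChartAt_target g₀
  have hopen : IsOpen (ψ.target ∩ ψ.symm ⁻¹' U) :=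
    (continuousOn_extChartAt_symm g₀).isOpen_inter_preimage
      (isOpen_extChartAt_target (I := 𝓘(ℝ, E)) g₀) hU
  have hmem : ψ g₀ ∈ ψ.target ∩ ψ.symm ⁻¹' U := ⟨hy, by
    rw [mem_preimage, hψ, extChartAt_to_inv]; exact hg₀⟩
  obtain ⟨r, hr, hball⟩ := Metric.isOpen_iff.1 hopen _ hmem
  have hder : ∀ z ∈ Metric.ball (ψ g₀) r, HasFDerivAt (fun z => f (ψ.symm z)) (0 : E →L[ℝ] ℝ) z := by
    intro z hz
    have hz' := hball hz
    have hfz := hf.contMDiffAt (hU.mem_nhds hz'.2)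
    have hd := ((contDiffAt_comp_extChartAt_symm hz'.1 hfz).differentiableAt (by simp)).hasFDerivAt
    have hz0 : fderiv ℝ (fun z => f (ψ.symm z)) z = 0 := by
      refine ContinuousLinearMap.ext fun v => ?_
      obtain ⟨X, rfl⟩ := (chartFrame_bijective hz'.1).2 v
      rw [← modelDeriv_rightVec_eq_fderiv hz'.1 (hfz.mdifferentiableAt (by simp))]
      exact h0 X _ hz'.2
    rwa [hz0] at hd
  have hconst : ∀ z ∈ Metric.ball (ψ g₀) r, f (ψ.symm z) = f (ψ.symm (ψ g₀)) := by
    intro z hz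
    exact (convex_ball (ψ g₀) r).is_const_of_fderivWithin_eq_zero
      (fun w hw => (hder w hw).differentiableAt.differentiableWithinAt)
      (fun w hw => by
        rw [fderivWithin_of_isOpen Metric.isOpen_ball hw, (hder w hw).fderiv])
      hz (Metric.mem_ball_self hr)
  filter_upwards [(continuousAt_extChartAt (I := 𝓘(ℝ, E)) g₀) (Metric.ball_mem_nhds _ hr),
    extChartAt_source_mem_nhds (I := 𝓘(ℝ, E)) g₀] with g hg hg'
  have := hconst _ hg
  rwa [ψ.left_inv hg', hψ, extChartAt_to_inv] at this

/-- The cochain is a 1-form written in the right-invariant frame, and `δB = 0` says that this form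
is closed. On a convex chart ball a closed form is exact. -/
theorem exists_local_primitive [FiniteDimensional ℝ E] {V : Set G} (hV : IsOpen V)
    {B : GroupLieAlgebra 𝓘(ℝ, E) G →ₗ[ℝ] (G → ℝ)} (hB : IsOneCochain V B)
    (hclosed : ∀ X Y, ∀ g ∈ V, coboundaryOne B X Y g = 0) {g₀ : G} (hg₀ : g₀ ∈ V) :
    ∃ (U : Set G) (f : G → ℝ), IsOpen U ∧ g₀ ∈ U ∧ U ⊆ V ∧ IsSmoothOn (E := E) U f ∧
      ∀ X, ∀ g ∈ U, rightDeriv X f g = B X g := by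
  have : CompleteSpace E := FiniteDimensional.complete ℝ E
  set ψ := extChartAt 𝓘(ℝ, E) g₀ with hψ
  have hy : ψ g₀ ∈ ψ.target := mem_extChartAt_target g₀
  have hopen : IsOpen (ψ.target ∩ ψ.symm ⁻¹' V) :=
    (continuousOn_extChartAt_symm g₀).isOpen_inter_preimage
      (isOpen_extChartAt_target (I := 𝓘(ℝ, E)) g₀) hV
  have hmem : ψ g₀ ∈ ψ.target ∩ ψ.symm ⁻¹' V := ⟨hy, by
    rw [mem_preimage, hψ, extChartAt_to_inv]; exact hg₀⟩
  obtain ⟨r, hr, hball⟩ := Metric.isOpen_iff.1 hopen _ hmem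
  set Ω := Metric.ball (ψ g₀) r with hΩ
  have hΩo : IsOpen Ω := Metric.isOpen_ball
  have hBs (X : E) {z : E} (hz : z ∈ Ω) : ContMDiffAt 𝓘(ℝ, E) 𝓘(ℝ, ℝ) ∞ (B X) (ψ.symm z) :=
    (hB X).contMDiffAt (hV.mem_nhds (hball hz).2)
  let b : E → E →L[ℝ] ℝ := fun z => LinearMap.toContinuousLinearMap
    { toFun := fun X : E => B X (ψ.symm z)
      map_add' := fun X Y => congrFun (B.map_add X Y) _
      map_smul' := fun a X => congrFun (B.map_smul a X) _ }
  have hb (z : E) (X : E) : b z X = B X (ψ.symm z) := rfl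
  have hbs : ContDiffOn ℝ ∞ b Ω := contDiffOn_clm_apply.2 fun X z hz =>
    (contDiffAt_comp_extChartAt_symm (hball hz).1 (hBs X hz)).contDiffWithinAt
  let e (z : E) (hz : z ∈ Ω) : E ≃L[ℝ] E := ContinuousLinearEquiv.ofBijective (chartFrame g₀ z)
    (LinearMap.ker_eq_bot.2 (chartFrame_bijective (hball hz).1).1)
    (LinearMap.range_eq_top.2 (chartFrame_bijective (hball hz).1).2)
  have he (z : E) (hz : z ∈ Ω) : (e z hz : E →L[ℝ] E) = chartFrame g₀ z := by ext; rfl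
  -- The 1-form whose value on the frame vector of `X` is `B X`. On `Ω` the frame is invertible, so
  -- `inverse` is a true inverse there and not the default value.
  let θ : E → E →L[ℝ] ℝ := fun z => (b z).comp (ContinuousLinearMap.inverse (chartFrame g₀ z))
  have hθξ (z : E) (hz : z ∈ Ω) (X : E) : θ z (chartFrame g₀ z X) = B X (ψ.symm z) := by
    have h1 : ContinuousLinearMap.inverse (chartFrame g₀ z) (chartFrame g₀ z X) = X := by
      rw [← he z hz, ContinuousLinearMap.inverse_equiv]
      exact (e z hz).symm_apply_apply X
    simp only [θ, ContinuousLinearMap.comp_apply, h1, hb]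
  have hθs : ContDiffOn ℝ ∞ θ Ω := by
    intro z hz
    have h1 : ContDiffAt ℝ ∞ ContinuousLinearMap.inverse (chartFrame (G := G) (E := E) g₀ z) := by
      rw [← he z hz]; exact contDiffAt_map_inverse _
    exact ((hbs z hz).contDiffAt (hΩo.mem_nhds hz)).clm_comp
      (h1.comp z (contDiffAt_chartFrame (hball hz).1)) |>.contDiffWithinAt
  have hθd (z : E) (hz : z ∈ Ω) : DifferentiableAt ℝ θ z :=
    ((hθs z hz).contDiffAt (hΩo.mem_nhds hz)).differentiableAt (by simp)
  have hder (z : E) (hz : z ∈ Ω) (X Y : GroupLieAlgebra 𝓘(ℝ, E) G) :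
      fderiv ℝ θ z (chartFrame (E := E) g₀ z Y) (chartFrame (E := E) g₀ z X)
        + θ z (fderiv ℝ (fun w => chartFrame (E := E) g₀ w X) z (chartFrame (E := E) g₀ z Y))
        = rightDeriv Y (B X) (ψ.symm z) := by
    have h1 : (fun w => θ w (chartFrame (E := E) g₀ w X)) =ᶠ[𝓝 z] fun w => B X (ψ.symm w) := by
      filter_upwards [hΩo.mem_nhds hz] with w hw
      exact hθξ w hw X
    have h2 := h1.fderiv_eq (𝕜 := ℝ)
    rw [fderiv_clm_apply (hθd z hz)
      ((contDiffAt_chartFrame_apply (hball hz).1 X).differentiableAt (by simp))] at h2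
    exact ((add_comm _ _).trans (DFunLike.congr_fun h2 (chartFrame (E := E) g₀ z Y))).trans
      (modelDeriv_rightVec_eq_fderiv (E := E) (hball hz).1
        ((hBs X hz).mdifferentiableAt (by simp)) Y).symm
  have hsymm : ∀ z ∈ Ω, ∀ u v, fderiv ℝ θ z u v = fderiv ℝ θ z v u := by
    intro z hz u v
    have key (X Y : GroupLieAlgebra 𝓘(ℝ, E) G) :
        fderiv ℝ θ z (chartFrame (E := E) g₀ z X) (chartFrame (E := E) g₀ z Y)
          = fderiv ℝ θ z (chartFrame (E := E) g₀ z Y) (chartFrame (E := E) g₀ z X) := by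
      -- The difference of the two product-rule identities is `η_Y B(X) - η_X B(Y)`; its frame terms
      -- are `θ` of the bracket, which is `B [X, Y]`. With `δB = 0` only the symmetry of `fderiv ℝ θ
      -- z` is left.
      have h1 := hder z hz X Y
      have h2 := hder z hz Y X
      have h3 := hclosed X Y _ (hball hz).2
      have h4 := hθξ z hz (⁅X, Y⁆ : GroupLieAlgebra 𝓘(ℝ, E) G)
      rw [← lieBracket_chartFrame (hball hz).1, VectorField.lieBracket_eq, map_sub] at h4
      simp only [coboundaryOne] at h3
      linarith
    obtain ⟨X, rfl⟩ := (chartFrame_bijective (hball hz).1).2 u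
    obtain ⟨Y, rfl⟩ := (chartFrame_bijective (hball hz).1).2 v
    exact key X Y
  obtain ⟨F, hF⟩ := (convex_ball (ψ g₀) r).exists_forall_hasFDerivAt_of_fderiv_symmetric hΩo
    (fun z hz => (hθd z hz).differentiableWithinAt) hsymm
  have hFs : ContDiffOn ℝ ∞ F Ω := by
    rw [contDiffOn_infty_iff_fderiv_of_isOpen hΩo]
    refine ⟨fun z hz => (hF z hz).differentiableAt.differentiableWithinAt, ?_⟩
    exact hθs.congr fun z hz => (hF z hz).fderiv
  refine ⟨ψ.source ∩ ψ ⁻¹' Ω, fun g => F (ψ g), ?_, ⟨mem_extChartAt_source g₀,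
    Metric.mem_ball_self hr⟩, ?_, ?_, ?_⟩
  · exact (continuousOn_extChartAt g₀).isOpen_inter_preimage
      (isOpen_extChartAt_source (I := 𝓘(ℝ, E)) g₀) hΩo
  · rintro g ⟨hg, hg'⟩
    have := (hball hg').2
    rwa [mem_preimage, ψ.left_inv hg] at this
  · rintro g ⟨hg, hg'⟩
    refine ContMDiffAt.contMDiffWithinAt ?_
    have h1 : ContMDiffAt 𝓘(ℝ, E) 𝓘(ℝ, ℝ) ∞ F (ψ g) :=
      ((hFs _ hg').contDiffAt (hΩo.mem_nhds hg')).contMDiffAt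
    exact h1.comp g (contMDiffAt_extChartAt' (by rwa [← extChartAt_source 𝓘(ℝ, E)]))
  · rintro X g ⟨hg, hg'⟩
    have hz := (hball hg').1
    have h1 : MDifferentiableAt 𝓘(ℝ, E) 𝓘(ℝ, ℝ) (fun g => F (ψ g)) (ψ.symm (ψ g)) := by
      rw [ψ.left_inv hg]
      exact ((hF _ hg').differentiableAt.mdifferentiableAt).comp g
        (mdifferentiableAt_extChartAt (by rwa [← extChartAt_source 𝓘(ℝ, E)]))
    have h2 := modelDeriv_rightVec_eq_fderiv (E := E) hz h1 X
    have h3 : (fun z => F (ψ (ψ.symm z))) =ᶠ[𝓝 (ψ g)] F := by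
      filter_upwards [eventually_extChartAt_right_inv hz] with z hz
      rw [hz]
    rw [h3.fderiv_eq, (hF _ hg').fderiv] at h2
    have h4 := h2.trans (hθξ _ hg' X)
    rw [← hψ, ψ.left_inv hg] at h4
    exact h4

end RightDerivatives

/-! ### Gluing over a simply connected base by a covering space -/

section SimplyConnected

/-- On a simply connected space, local functions that differ by locally constant functions can be
glued up to locally constant functions. -/
theorem exists_glue_of_locally_const {B : Type*} [TopologicalSpace B] [SimplyConnectedSpace B]
    [LocallyPathConnectedSpace B] {F : Type*} [AddCommGroup F] (U : B → Set B) (f : B → B → F)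
    (hU : ∀ i, IsOpen (U i)) (hmem : ∀ i, i ∈ U i)
    (hf : ∀ i j, ∀ x ∈ U i ∩ U j, ∀ᶠ y in 𝓝 x, f j y - f i y = f j x - f i x) :
    ∃ φ : B → F, ∀ i, ∀ x ∈ U i, ∀ᶠ y in 𝓝 x, φ y - f i y = φ x - f i x := by
  let _ : TopologicalSpace F := ⊥
  have : DiscreteTopology F := ⟨rfl⟩
  -- The differences `f j - f i` serve as transition functions. As they are locally constant and the
  -- fibre is discrete, the bundle is a covering, and simple connectedness lifts the identity to a
  -- global section `σ`.
  let Z : FiberBundleCore B B F :=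
    { baseSet := U
      isOpen_baseSet := hU
      indexAt := id
      mem_baseSet_at := hmem
      coordChange := fun i j x v => v + (f j x - f i x)
      coordChange_self := fun i x _ v => by simp
      continuousOn_coordChange := by
        rintro i j ⟨x, v⟩ ⟨hx, -⟩
        refine ContinuousAt.continuousWithinAt ?_
        have h1 : ContinuousAt (fun p : B × F => p.2 + (f j x - f i x)) (x, v) :=
          (continuous_of_discreteTopology (f := fun w : F => w + (f j x - f i x))).continuousAt.comp
            continuousAt_snd
        refine h1.congr ?_
        filter_upwards [(hf i j x hx).prod_inl_nhds v] with p hp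
        rw [hp]
      coordChange_comp := fun i j k x _ v => by abel }
  have hcov : IsCoveringMap (Bundle.TotalSpace.proj : Z.TotalSpace → B) :=
    FiberBundle.isCoveringMap (F := F) (E := Z.Fiber)
  have a₀ : B := Classical.arbitrary B
  obtain ⟨σ, ⟨-, hσ⟩, -⟩ := hcov.existsUnique_continuousMap_lifts (ContinuousMap.id B) a₀
    (⟨a₀, (0 : F)⟩ : Z.TotalSpace) rfl
  have hσ' (x : B) : (σ x).proj = x := congrFun hσ x
  let v : B → F := fun x => (σ x).snd
  -- In the trivialization `i` the section has the coordinate `-(φ - f i)`, which is continuous with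
  -- discrete values, hence locally constant.
  refine ⟨fun x => f x x - v x, fun i x hx => ?_⟩
  have htriv (y : B) : (Z.localTriv i (σ y)).2 = v y + (f i y - f y y) := by
    have : (Z.localTriv i (σ y)).2 = v y + (f i (σ y).proj - f (σ y).proj (σ y).proj) := rfl
    rw [this, hσ']
  have hc : ContinuousAt (fun y => (Z.localTriv i (σ y)).2) x := by
    refine continuousAt_snd.comp ?_
    refine ContinuousAt.comp (g := Z.localTriv i) ?_ σ.continuous.continuousAt
    refine (Z.localTriv i).continuousAt ?_
    have hx' : (σ x).proj ∈ U i := by rwa [hσ']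
    exact (Z.localTriv i).mem_source.2 hx'
  have hev := hc.eventually (show ∀ᶠ w in 𝓝 (Z.localTriv i (σ x)).2, w = (Z.localTriv i (σ x)).2 by
    rw [nhds_discrete]; exact rfl)
  filter_upwards [hev] with y hy
  rw [htriv, htriv] at hy
  have h1 : f y y - v y - f i y = -(v y + (f i y - f y y)) := by abel
  have h2 : f x x - v x - f i x = -(v x + (f i x - f x x)) := by abel
  rw [h1, h2, hy]

end SimplyConnected

/-! ### Global primitives of closed cochains -/

section Primitive

variable {E : Type*} [NormedAddCommGroup E] [NormedSpace ℝ E]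
  {G : Type*} [TopologicalSpace G] [ChartedSpace E G] [Group G]

theorem rightDeriv_congr {f f' : G → ℝ} {g : G} (h : f =ᶠ[𝓝 g] f')
    (X : GroupLieAlgebra 𝓘(ℝ, E) G) : rightDeriv X f g = rightDeriv X f' g := by
  rw [rightDeriv_eq_modelDeriv, rightDeriv_eq_modelDeriv, modelDeriv_congr h]

theorem rightDeriv_add {f f' : G → ℝ} {g : G} (hf : MDifferentiableAt 𝓘(ℝ, E) 𝓘(ℝ, ℝ) f g)
    (hf' : MDifferentiableAt 𝓘(ℝ, E) 𝓘(ℝ, ℝ) f' g) (X : GroupLieAlgebra 𝓘(ℝ, E) G) :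
    rightDeriv X (f + f') g = rightDeriv X f g + rightDeriv X f' g :=
  DFunLike.congr_fun (F := E →L[ℝ] ℝ) (mfderiv_add hf hf') (rightVec E g X)

theorem rightDeriv_sub {f f' : G → ℝ} {g : G} (hf : MDifferentiableAt 𝓘(ℝ, E) 𝓘(ℝ, ℝ) f g)
    (hf' : MDifferentiableAt 𝓘(ℝ, E) 𝓘(ℝ, ℝ) f' g) (X : GroupLieAlgebra 𝓘(ℝ, E) G) :
    rightDeriv X (f - f') g = rightDeriv X f g - rightDeriv X f' g :=
  DFunLike.congr_fun (F := E →L[ℝ] ℝ) (mfderiv_sub hf hf') (rightVec E g X)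

theorem exists_primitive [FiniteDimensional ℝ E] [LieGroup 𝓘(ℝ, E) ∞ G] {V : Set G} (hV : IsOpen V) [SimplyConnectedSpace V]
    {B : GroupLieAlgebra 𝓘(ℝ, E) G →ₗ[ℝ] (G → ℝ)} (hB : IsOneCochain V B)
    (hclosed : ∀ X Y, ∀ g ∈ V, coboundaryOne B X Y g = 0) :
    ∃ φ : G → ℝ, IsSmoothOn (E := E) V φ ∧ ∀ X, ∀ g ∈ V, rightDeriv X φ g = B X g := by
  classical
  have : LocallyPathConnectedSpace G := ChartedSpace.locallyPathConnectedSpace E G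
  have : LocallyPathConnectedSpace V := hV.locallyPathConnectedSpace
  choose U f hUo hmem hUV hfs hfd using fun g : V => exists_local_primitive hV hB hclosed g.2
  have hsm (i : V) {g : G} (hg : g ∈ U i) : ContMDiffAt 𝓘(ℝ, E) 𝓘(ℝ, ℝ) ∞ (f i) g :=
    (hfs i).contMDiffAt ((hUo i).mem_nhds hg)
  obtain ⟨φ, hφ⟩ := exists_glue_of_locally_const (fun i : V => (Subtype.val ⁻¹' U i : Set V))
    (fun i x => f i x) (fun i => (hUo i).preimage continuous_subtype_val) hmem (by
      rintro i j x ⟨hi, hj⟩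
      have h1 : ∀ᶠ g in 𝓝 (x : G), (f j - f i) g = (f j - f i) x := by
        refine eventually_eq_of_rightDeriv_eq_zero (E := E) ((hUo i).inter (hUo j)) ?_ ?_ ⟨hi, hj⟩
        · exact ((hfs j).mono inter_subset_right).sub ((hfs i).mono inter_subset_left)
        · rintro X g ⟨hgi, hgj⟩
          rw [rightDeriv_sub ((hsm j hgj).mdifferentiableAt (by simp))
            ((hsm i hgi).mdifferentiableAt (by simp)), hfd j X g hgj, hfd i X g hgi, sub_self]
      exact continuous_subtype_val.continuousAt.eventually h1)
  let Φ : G → ℝ := fun g => if h : g ∈ V then φ ⟨g, h⟩ else 0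
  -- Near each point of `V` the glued function is a local primitive plus a constant, so smoothness
  -- and derivatives are inherited from the local primitive.
  have hΦ (g : V) : Φ =ᶠ[𝓝 (g : G)] fun h => f g h + (φ g - f g g) := by
    have h1 := hφ g g (hmem g)
    rw [nhds_subtype_eq_comap, eventually_comap] at h1
    filter_upwards [h1, hV.mem_nhds g.2] with h hh hhV
    have := hh ⟨h, hhV⟩ rfl
    simp only [Φ, dif_pos hhV]
    linarith
  refine ⟨Φ, fun g hg => ?_, fun X g hg => ?_⟩
  · refine ContMDiffAt.contMDiffWithinAt ?_
    refine ContMDiffAt.congr_of_eventuallyEq ?_ (hΦ ⟨g, hg⟩)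
    exact (hsm ⟨g, hg⟩ (hmem ⟨g, hg⟩)).add contMDiffAt_const
  · have h1 := rightDeriv_add (E := E) (f' := fun _ : G => φ ⟨g, hg⟩ - f ⟨g, hg⟩ g)
      ((hsm ⟨g, hg⟩ (hmem ⟨g, hg⟩)).mdifferentiableAt (by simp)) mdifferentiableAt_const X
    rw [rightDeriv_congr (hΦ ⟨g, hg⟩)]
    refine h1.trans ?_
    rw [hfd ⟨g, hg⟩ X g (hmem ⟨g, hg⟩), rightDeriv_eq_modelDeriv, modelDeriv_const, add_zero]

end Primitive

/-! ### One-parameter subgroups -/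

section OneParameter

variable {E : Type*} [NormedAddCommGroup E] [NormedSpace ℝ E]
  {G : Type*} [TopologicalSpace G] [ChartedSpace E G] [Group G]

theorem eventually_eq_const_of_modelDeriv_eq_zero {M : Type*} [TopologicalSpace M]
    [ChartedSpace E M] [IsManifold 𝓘(ℝ, E) ∞ M] {f : ℝ → M}
    (hf : MDifferentiable 𝓘(ℝ, ℝ) 𝓘(ℝ, E) f)
    (h0 : ∀ τ, modelDeriv 𝓘(ℝ, ℝ) 𝓘(ℝ, E) f τ 1 = 0) (τ₀ : ℝ) :
    ∀ᶠ τ in 𝓝 τ₀, f τ = f τ₀ := by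
  have : IsManifold 𝓘(ℝ, E) 1 M := IsManifold.of_le (n := ∞) (by simp)
  set ψ := extChartAt 𝓘(ℝ, E) (f τ₀) with hψ
  have hev : ∀ᶠ τ in 𝓝 τ₀, f τ ∈ ψ.source :=
    (hf τ₀).continuousAt (extChartAt_source_mem_nhds (I := 𝓘(ℝ, E)) (f τ₀))
  obtain ⟨r, hr, hball⟩ := Metric.eventually_nhds_iff_ball.1 hev
  have hder : ∀ τ ∈ Metric.ball τ₀ r, HasFDerivAt (fun σ => ψ (f σ)) (0 : ℝ →L[ℝ] E) τ := by
    intro τ hτ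
    have hψd : MDifferentiableAt 𝓘(ℝ, E) 𝓘(ℝ, E) ψ (f τ) :=
      mdifferentiableAt_extChartAt (by
        rw [← extChartAt_source 𝓘(ℝ, E)]
        exact hball τ hτ)
    have hd : MDifferentiableAt 𝓘(ℝ, ℝ) 𝓘(ℝ, E) (fun σ => ψ (f σ)) τ := hψd.comp τ (hf τ)
    have h1 := modelDeriv_comp τ hψd (hf τ) (1 : ℝ)
    rw [h0, map_zero, modelDeriv_eq_fderiv] at h1
    have h2 : fderiv ℝ (fun σ => ψ (f σ)) τ = 0 := by
      ext
      exact h1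
    rw [← h2]
    exact hd.differentiableAt.hasFDerivAt
  filter_upwards [Metric.ball_mem_nhds τ₀ hr] with τ hτ
  refine ψ.injOn (hball τ hτ) (mem_extChartAt_source (f τ₀)) ?_
  exact (convex_ball τ₀ r).is_const_of_fderivWithin_eq_zero
    (fun w hw => (hder w hw).differentiableAt.differentiableWithinAt)
    (fun w hw => by rw [fderivWithin_of_isOpen Metric.isOpen_ball hw, (hder w hw).fderiv])
    hτ (Metric.mem_ball_self hr)

namespace IsOneParameterSubgroup

variable {c : ℝ → G} {Z : GroupLieAlgebra 𝓘(ℝ, E) G} (hc : IsOneParameterSubgroup c Z)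

include hc

theorem modelDeriv_zero : modelDeriv 𝓘(ℝ, ℝ) 𝓘(ℝ, E) c 0 1 = (Z : E) := hc.velocity

theorem mdifferentiable : MDifferentiable 𝓘(ℝ, ℝ) 𝓘(ℝ, E) c := hc.contMDiff.mdifferentiable (by simp)

/-- The velocity at `τ` of a curve `τ ↦ c τ * h`. -/
theorem modelDeriv_mul [LieGroup 𝓘(ℝ, E) ∞ G] (h : G) (τ : ℝ) :
    modelDeriv 𝓘(ℝ, ℝ) 𝓘(ℝ, E) (fun σ => c σ * h) τ 1 = -rightVec E (c τ * h) (Z : E) := by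
  have h1 : (fun σ => c σ * h) = fun σ => c (σ - τ) * (c τ * h) := by
    funext σ
    rw [← mul_assoc, ← hc.map_add, sub_add_cancel]
  have hsub : MDifferentiableAt 𝓘(ℝ, ℝ) 𝓘(ℝ, ℝ) (fun σ : ℝ => σ - τ) τ :=
    (differentiableAt_id.sub_const τ).mdifferentiableAt
  have hcs : MDifferentiableAt 𝓘(ℝ, ℝ) 𝓘(ℝ, E) (fun σ : ℝ => c (σ - τ)) τ :=
    MDifferentiableAt.comp (g := c) (f := fun σ : ℝ => σ - τ) τ (hc.mdifferentiable (τ - τ)) hsub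
  have h2 := modelDeriv_comp τ (g := fun k : G => k * (c τ * h)) (f := fun σ : ℝ => c (σ - τ))
    (mdifferentiable_mul_right (E := E) _ _) hcs (1 : ℝ)
  have h3 := modelDeriv_comp τ (g := c) (f := fun σ : ℝ => σ - τ) (hc.mdifferentiable _) hsub (1 : ℝ)
  have h4 : modelDeriv 𝓘(ℝ, ℝ) 𝓘(ℝ, ℝ) (fun σ : ℝ => σ - τ) τ 1 = 1 := by
    rw [modelDeriv_eq_fderiv, fderiv_sub_const]
    exact DFunLike.congr_fun (fderiv_fun_id (𝕜 := ℝ) (x := τ)) (1 : ℝ)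
  rw [h4, sub_self, hc.modelDeriv_zero] at h3
  rw [h1, h2, h3, sub_self, hc.map_zero]
  exact (neg_neg _).symm

end IsOneParameterSubgroup

end OneParameter

namespace CentralExtension

/-! ### The fibre coordinate of the central extension -/

section Fibre

variable {E : Type*} [NormedAddCommGroup E] [NormedSpace ℝ E]
  {G : Type*} [TopologicalSpace G] [ChartedSpace E G] [Group G]
  {E' : Type*} [NormedAddCommGroup E'] [NormedSpace ℝ E']
  {G' : Type*} [TopologicalSpace G'] [ChartedSpace E' G'] [Group G']
  {B : GroupLieAlgebra 𝓘(ℝ, E) G →ₗ[ℝ] GroupLieAlgebra 𝓘(ℝ, E) G →ₗ[ℝ] ℝ}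
  (P : CentralExtension (E' := E') G' B)

theorem mdifferentiable_proj : MDifferentiable 𝓘(ℝ, E') 𝓘(ℝ, E) P.proj :=
  P.contMDiff_proj.mdifferentiable (by simp)

theorem proj_mul_of_mem (h : G') {t : G'} (ht : t ∈ P.T) : P.proj (h * t) = P.proj h := by
  rw [map_mul, MonoidHom.mem_ker.1 (P.T_le_ker ht), mul_one]

theorem mul_comm_of_mem (h : G') {t : G'} (ht : t ∈ P.T) : h * t = t * h :=
  Subgroup.mem_center_iff.1 (P.T_le_center ht) h

theorem modelDeriv_proj_lift (X : GroupLieAlgebra 𝓘(ℝ, E) G) :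
    modelDeriv 𝓘(ℝ, E') 𝓘(ℝ, E) P.proj 1 (P.lift X : E') = (X : E) := P.mfderiv_proj (X, 0)

theorem modelDeriv_proj_Z : modelDeriv 𝓘(ℝ, E') 𝓘(ℝ, E) P.proj 1 (P.Z : E') = 0 :=
  P.mfderiv_proj (0, 1)

theorem lie_eq_lift_add (X : GroupLieAlgebra 𝓘(ℝ, E) G) (a : ℝ) :
    P.lie (X, a) = P.lift X + a • P.Z := by
  rw [lift, Z, ← map_smul, ← map_add]
  simp

/-- The kernel of `dπ` at the identity is exactly `ℝ Z`, as seen from the identification with `𝔤 ⊕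
ℝ`. -/
theorem exists_eq_smul_Z {W : GroupLieAlgebra 𝓘(ℝ, E') G'}
    (hW : modelDeriv 𝓘(ℝ, E') 𝓘(ℝ, E) P.proj 1 (W : E') = 0) : ∃ a : ℝ, W = a • P.Z := by
  obtain ⟨⟨X, a⟩, rfl⟩ := P.lie.surjective W
  have hX : X = 0 := (P.mfderiv_proj (X, a)).symm.trans hW
  refine ⟨a, ?_⟩
  rw [hX, Z, ← map_smul]
  simp

theorem Z_ne_zero : (P.Z : E') ≠ 0 := by
  intro h
  have : P.lie (0, 1) = P.lie 0 := h.trans (map_zero P.lie).symm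
  have := P.lie.injective this
  simpa using congrArg Prod.snd this

theorem bracket_lift (X Y : GroupLieAlgebra 𝓘(ℝ, E) G) :
    ⁅P.lift X, P.lift Y⁆ = P.lift ⁅X, Y⁆ + B X Y • P.Z := by
  rw [← lie_eq_lift_add, lift, lift, P.lie_bracket]
  rfl

variable {P} in
theorem IsSection.contMDiffAt {V : Set G} {s : G → G'} (hs : P.IsSection V s) {g : G}
    (hg : g ∈ V) : ContMDiffAt 𝓘(ℝ, E) 𝓘(ℝ, E') ∞ s g :=
  hs.contMDiffOn.contMDiffAt (hs.isOpen.mem_nhds hg)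

variable [LieGroup 𝓘(ℝ, E) ∞ G] [LieGroup 𝓘(ℝ, E') ∞ G']

theorem modelDeriv_proj_rightVec (W : E') (h : G') :
    modelDeriv 𝓘(ℝ, E') 𝓘(ℝ, E) P.proj h (rightVec E' h W)
      = rightVec E (P.proj h) (modelDeriv 𝓘(ℝ, E') 𝓘(ℝ, E) P.proj 1 W) :=
  modelDeriv_hom_rightVec P.proj P.mdifferentiable_proj W h

variable {P} {c : ℝ → G'} (hc : IsOneParameterSubgroup c P.Z)

include hc

/-- The curve `π ∘ c` has zero velocity because `dπ` kills `Z`. So `c` stays in `ker π` near `0`,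
where it is also in the neighbourhood of `1` on which `ker π` lies in `T`. -/
theorem eventually_mem_T : ∀ᶠ τ in 𝓝 (0 : ℝ), c τ ∈ P.T := by
  obtain ⟨O, hO, h1, hT⟩ := P.T_open
  have hcO : ∀ᶠ τ in 𝓝 (0 : ℝ), c τ ∈ O :=
    hc.contMDiff.continuous.continuousAt (hO.mem_nhds (by rwa [hc.map_zero]))
  have hconst := eventually_eq_const_of_modelDeriv_eq_zero (f := fun τ => P.proj (c τ))
    (P.mdifferentiable_proj.comp hc.mdifferentiable) (fun τ => by
      have h1 := modelDeriv_comp τ (P.mdifferentiable_proj (c τ)) (hc.mdifferentiable τ) (1 : ℝ)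
      have h2 := hc.modelDeriv_mul 1 τ
      simp only [mul_one] at h2
      rw [h2, map_neg] at h1
      have h3 := P.modelDeriv_proj_rightVec (P.Z : E') (c τ)
      rw [P.modelDeriv_proj_Z, map_zero] at h3
      exact h1.trans (neg_eq_zero.2 h3)) 0
  filter_upwards [hcO, hconst] with τ h2 h3
  refine hT _ h2 ?_
  rw [h3, hc.map_zero, map_one]

/-- All times follow from small ones by `c τ = c (τ / n) ^ n` with `n` large. -/
theorem mem_T (τ : ℝ) : c τ ∈ P.T := by
  have hlim : Tendsto (fun n : ℕ => τ / (n : ℝ)) atTop (𝓝 0) :=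
    tendsto_const_div_atTop_nhds_zero_nat τ
  obtain ⟨n, hn, hn0⟩ := ((hlim.eventually (eventually_mem_T hc)).and
    (eventually_gt_atTop 0)).exists
  have hpow (k : ℕ) (σ : ℝ) : c (k * σ) = c σ ^ k := by
    induction k with
    | zero => simp [hc.map_zero]
    | succ k ih => rw [Nat.cast_succ, add_mul, one_mul, hc.map_add, ih, pow_succ]
  have : c τ = c (τ / n) ^ n := by
    rw [← hpow]
    congr 1
    field_simp
  rw [this]
  exact P.T.pow_mem hn n

theorem proj_mul_apply (h : G') (τ : ℝ) : P.proj (h * c τ) = P.proj h :=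
  P.proj_mul_of_mem h (mem_T hc τ)

variable {V : Set G} {s : G → G'} (hs : P.IsSection V s)

include hs

omit [LieGroup 𝓘(ℝ, E) ∞ G] in
theorem contMDiffAt_section_mul {g : G} (hg : g ∈ V) (τ : ℝ) :
    ContMDiffAt (𝓘(ℝ, E).prod 𝓘(ℝ, ℝ)) 𝓘(ℝ, E') ∞ (fun q : G × ℝ => s q.1 * c q.2) (g, τ) :=
  (ContMDiffAt.comp (g := s) (f := Prod.fst) (g, τ) (hs.contMDiffAt hg) contMDiffAt_fst).mul
    (ContMDiffAt.comp (g := c) (f := Prod.snd) (g, τ) hc.contMDiff.contMDiffAt contMDiffAt_snd)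

omit [LieGroup 𝓘(ℝ, E) ∞ G] in
theorem mdifferentiableAt_section_mul {g : G} (hg : g ∈ V) (τ : ℝ) :
    MDifferentiableAt (𝓘(ℝ, E).prod 𝓘(ℝ, ℝ)) 𝓘(ℝ, E') (fun q : G × ℝ => s q.1 * c q.2) (g, τ) :=
  (contMDiffAt_section_mul hc hs hg τ).mdifferentiableAt (by simp)

/-- The differential of the projection in the coordinates `(g, τ) ↦ s g * c τ`. -/
theorem modelDeriv_proj_section_mul {g : G} (hg : g ∈ V) (τ : ℝ) (v : E) (r : ℝ) :
    modelDeriv 𝓘(ℝ, E') 𝓘(ℝ, E) P.proj (s g * c τ)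
      (modelDeriv (𝓘(ℝ, E).prod 𝓘(ℝ, ℝ)) 𝓘(ℝ, E') (fun q : G × ℝ => s q.1 * c q.2) (g, τ) (v, r))
      = v := by
  have h1 := modelDeriv_comp (I := 𝓘(ℝ, E).prod 𝓘(ℝ, ℝ)) (g, τ)
    (P.mdifferentiable_proj (s g * c τ)) (mdifferentiableAt_section_mul hc hs hg τ) (v, r)
  have h2 : (fun q : G × ℝ => P.proj (s q.1 * c q.2)) =ᶠ[𝓝 (g, τ)] Prod.fst := by
    filter_upwards [continuous_fst.continuousAt (hs.isOpen.mem_nhds hg)] with q hq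
    rw [proj_mul_apply hc, hs.proj_apply _ hq]
  rw [modelDeriv_congr h2] at h1
  refine h1.symm.trans ?_
  exact DFunLike.congr_fun (F := E × ℝ →L[ℝ] E) (mfderiv_fst (I := 𝓘(ℝ, E)) (I' := 𝓘(ℝ, ℝ))
    (x := (g, τ))) (v, r)

/-- Since `c σ` is central, `s g * c σ = c σ * s g`, and the velocity of the latter curve is a
right-invariant field: `∂/∂g⁰ = -η̃_Z`. -/
theorem modelDeriv_section_mul_zero {g : G} (hg : g ∈ V) (τ r : ℝ) :
    modelDeriv (𝓘(ℝ, E).prod 𝓘(ℝ, ℝ)) 𝓘(ℝ, E') (fun q : G × ℝ => s q.1 * c q.2) (g, τ) (0, r)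
      = -(r • rightVec E' (s g * c τ) (P.Z : E')) := by
  rw [modelDeriv_prod (mdifferentiableAt_section_mul hc hs hg τ), map_zero, zero_add]
  have h1 : (fun σ => s g * c σ) = fun σ => c σ * s g := by
    funext σ
    exact P.mul_comm_of_mem _ (mem_T hc σ)
  have h2 : r = r • (1 : ℝ) := by simp
  rw [h2, map_smul]
  simp only [h1]
  rw [hc.modelDeriv_mul, P.mul_comm_of_mem (s g) (mem_T hc τ), smul_neg]
  simp

theorem injective_modelDeriv_section_mul {g : G} (hg : g ∈ V) (τ : ℝ) :
    Function.Injective (modelDeriv (𝓘(ℝ, E).prod 𝓘(ℝ, ℝ)) 𝓘(ℝ, E')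
      (fun q : G × ℝ => s q.1 * c q.2) (g, τ)) := by
  rw [injective_iff_map_eq_zero]
  rintro ⟨v, r⟩ h
  have hv := modelDeriv_proj_section_mul hc hs hg τ v r
  rw [h, map_zero] at hv
  subst hv
  rw [modelDeriv_section_mul_zero hc hs hg, neg_eq_zero, smul_eq_zero] at h
  rcases h with rfl | h
  · rfl
  · exact absurd ((rightVec_bijective _).1 (h.trans (map_zero _).symm)) P.Z_ne_zero

/-- Subtract from `w` the image of its projection `v`. The remainder is killed by `dπ`, so it is a
right-invariant vector in a direction `a • Z`, reached by `(0, -a)`. -/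
theorem surjective_modelDeriv_section_mul {g : G} (hg : g ∈ V) (τ : ℝ) :
    Function.Surjective (modelDeriv (𝓘(ℝ, E).prod 𝓘(ℝ, ℝ)) 𝓘(ℝ, E')
      (fun q : G × ℝ => s q.1 * c q.2) (g, τ)) := by
  intro w
  set D := modelDeriv (𝓘(ℝ, E).prod 𝓘(ℝ, ℝ)) 𝓘(ℝ, E') (fun q : G × ℝ => s q.1 * c q.2) (g, τ)
  set v := modelDeriv 𝓘(ℝ, E') 𝓘(ℝ, E) P.proj (s g * c τ) w
  obtain ⟨W, hW⟩ := (rightVec_bijective (E := E') (s g * c τ)).2 (w - D (v, 0))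
  have h1 := P.modelDeriv_proj_rightVec W (s g * c τ)
  rw [hW, map_sub, modelDeriv_proj_section_mul hc hs hg τ v 0, sub_self] at h1
  have h2 := (rightVec_bijective (E := E) _).1 (h1.symm.trans (map_zero _).symm)
  obtain ⟨a, ha⟩ := P.exists_eq_smul_Z h2
  refine ⟨(v, 0) + (0, -a), ?_⟩
  have h3 : rightVec E' (s g * c τ) W = a • rightVec E' (s g * c τ) (P.Z : E') := by
    rw [ha]
    exact map_smul _ _ _
  rw [map_add, modelDeriv_section_mul_zero hc hs hg, neg_smul, neg_neg, ← h3, hW]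
  abel

/-- A smooth coordinate along the fibres near a point of the section. -/
theorem exists_fibre_coordinate [FiniteDimensional ℝ E] [FiniteDimensional ℝ E'] {g : G}
    (hg : g ∈ V) : ∃ τ : G' → ℝ, ContMDiffAt 𝓘(ℝ, E') 𝓘(ℝ, ℝ) ∞ τ (s g) ∧ τ (s g) = 0 ∧
      ∀ᶠ h in 𝓝 (s g), s (P.proj h) * c (τ h) = h := by
  have h0 : s g * c 0 = s g := by rw [hc.map_zero, mul_one]
  obtain ⟨k, hk, hkg, hkinv⟩ := exists_local_right_inverse (I := 𝓘(ℝ, E).prod 𝓘(ℝ, ℝ))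
    (contMDiffAt_section_mul hc hs hg 0)
    ⟨injective_modelDeriv_section_mul hc hs hg 0, surjective_modelDeriv_section_mul hc hs hg 0⟩
  simp only [h0] at hk hkg hkinv
  refine ⟨fun h => (k h).2, contMDiffAt_snd.comp _ hk, congrArg Prod.snd hkg, ?_⟩
  have hV : ∀ᶠ h in 𝓝 (s g), (k h).1 ∈ V := by
    have : ContinuousAt (fun h => (k h).1) (s g) := continuousAt_fst.comp hk.continuousAt
    refine this (hs.isOpen.mem_nhds ?_)
    beta_reduce
    rwa [hkg]
  filter_upwards [hkinv, hV] with h h1 h2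
  -- The first component of the local inverse is forced to be `π h`: apply `π` to `s (k h).1 * c (k
  -- h).2 = h`.
  have h3 : P.proj h = (k h).1 := by
    have := proj_mul_apply hc (s (k h).1) (k h).2
    rwa [h1, hs.proj_apply _ h2] at this
  rw [h3, h1]

end Fibre

end CentralExtension

/-- The functional equation `f σ = f τ * f (σ - τ)` spreads the derivative at `0` to all small `τ`
and gives `f' = -f`, so `f σ * exp σ` is constant on a ball. -/
theorem eventually_eq_exp_neg_of_map_add {f : ℝ → ℝ} (hf0 : f 0 = 1) (hf : HasDerivAt f (-1) 0)
    (hadd : ∀ᶠ p in 𝓝 ((0 : ℝ), (0 : ℝ)), f (p.1 + p.2) = f p.1 * f p.2) :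
    ∀ᶠ τ in 𝓝 (0 : ℝ), f τ = Real.exp (-τ) := by
  have hadd' := hadd.eventually_nhds
  have h1 : ∀ᶠ τ in 𝓝 (0 : ℝ), ∀ᶠ p in 𝓝 (τ, (0 : ℝ)), f (p.1 + p.2) = f p.1 * f p.2 := by
    have hc : ContinuousAt (fun τ : ℝ => (τ, (0 : ℝ))) 0 := by fun_prop
    exact hc.eventually hadd'
  have hder : ∀ᶠ τ in 𝓝 (0 : ℝ), HasDerivAt f (-f τ) τ := by
    filter_upwards [h1] with τ hτ
    have hc : ContinuousAt (fun σ : ℝ => (τ, σ - τ)) τ := by fun_prop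
    have h2 : ∀ᶠ σ in 𝓝 τ, f σ = f τ * f (σ - τ) := by
      have hτ' : ∀ᶠ p in 𝓝 (τ, τ - τ), f (p.1 + p.2) = f p.1 * f p.2 := by rwa [sub_self]
      filter_upwards [hc.eventually hτ'] with σ hσ
      simpa using hσ
    have h3 : HasDerivAt (fun σ => f τ * f (σ - τ)) (f τ * -1) τ := by
      have h4 : HasDerivAt f (-1) (τ - τ) := by rwa [sub_self]
      exact (h4.comp_sub_const τ τ).const_mul (f τ)
    rw [mul_neg_one] at h3
    exact h3.congr_of_eventuallyEq h2
  obtain ⟨r, hr, hball⟩ := Metric.eventually_nhds_iff_ball.1 hder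
  have hder' : ∀ τ ∈ Metric.ball (0 : ℝ) r, HasDerivAt (fun σ => f σ * Real.exp σ) 0 τ := by
    intro τ hτ
    have := (hball τ hτ).mul (Real.hasDerivAt_exp τ)
    rwa [neg_mul, neg_add_cancel] at this
  filter_upwards [Metric.ball_mem_nhds (0 : ℝ) hr] with τ hτ
  have := (convex_ball (0 : ℝ) r).is_const_of_fderivWithin_eq_zero (𝕜 := ℝ)
    (fun w hw => (hder' w hw).differentiableAt.differentiableWithinAt)
    (fun w hw => by
      rw [fderivWithin_of_isOpen Metric.isOpen_ball hw, (hder' w hw).hasFDerivAt.fderiv]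
      ext
      simp)
    hτ (Metric.mem_ball_self hr)
  simp only [hf0, Real.exp_zero, mul_one] at this
  rw [Real.exp_neg]
  exact eq_inv_of_mul_eq_one_left this

namespace CentralExtension

/-! ### The function `U`, its logarithmic derivative and the equation for the potential -/

section Character

variable {E : Type*} [NormedAddCommGroup E] [NormedSpace ℝ E]
  {G : Type*} [TopologicalSpace G] [ChartedSpace E G] [Group G]
  {E' : Type*} [NormedAddCommGroup E'] [NormedSpace ℝ E']
  {G' : Type*} [TopologicalSpace G'] [ChartedSpace E' G'] [Group G']
  {B : GroupLieAlgebra 𝓘(ℝ, E) G →ₗ[ℝ] GroupLieAlgebra 𝓘(ℝ, E) G →ₗ[ℝ] ℝ}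
  {P : CentralExtension (E' := E') G' B} {T₀ : Set G'} {χ : G' → ℝ}

theorem IsCharacter.mem_T (hχ : P.IsCharacter T₀ χ) {t : G'} (ht : t ∈ T₀) : t ∈ P.T := by
  obtain ⟨O, -, rfl⟩ := hχ.relOpen
  exact ht.2

theorem IsCharacter.map_one (hχ : P.IsCharacter T₀ χ) : χ 1 = 1 := by
  have h := hχ.map_mul 1 hχ.one_mem 1 hχ.one_mem (by rw [mul_one]; exact hχ.one_mem)
  rw [mul_one] at h
  exact (mul_eq_left₀ (hχ.ne_zero 1 hχ.one_mem)).1 h.symm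

theorem logDeriv_eq_of_eventuallyEq {U τ : G' → ℝ} {h : G'} {a : ℝ} (ha : a ≠ 0)
    (hτ : MDifferentiableAt 𝓘(ℝ, E') 𝓘(ℝ, ℝ) τ h)
    (hU : U =ᶠ[𝓝 h] fun k => a * Real.exp (-τ k)) (X : GroupLieAlgebra 𝓘(ℝ, E) G) :
    P.logDeriv U X h = -rightDeriv (P.lift X) τ h := by
  have hexp : HasDerivAt (fun r : ℝ => a * Real.exp (-r)) (a * (Real.exp (-τ h) * -1)) (τ h) :=
    ((hasDerivAt_neg (τ h)).exp).const_mul a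
  have h1 := modelDeriv_comp h (g := fun r : ℝ => a * Real.exp (-r)) (f := τ)
    hexp.differentiableAt.mdifferentiableAt hτ (rightVec E' h (P.lift X : E'))
  rw [modelDeriv_eq_fderiv, hexp.hasFDerivAt.fderiv] at h1
  have h2 : rightDeriv (P.lift X) U h = rightDeriv (P.lift X) τ h * (a * (Real.exp (-τ h) * -1)) := by
    rw [rightDeriv_congr hU]
    exact h1
  rw [logDeriv, h2, hU.self_of_nhds]
  have := Real.exp_ne_zero (-τ h)
  field_simp

theorem modelDeriv_comp_mul_right [LieGroup 𝓘(ℝ, E) ∞ G] {f : G → ℝ} {g : G}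
    (hf : MDifferentiableAt 𝓘(ℝ, E) 𝓘(ℝ, ℝ) f g) (t : G) (X : E) :
    modelDeriv 𝓘(ℝ, E) 𝓘(ℝ, ℝ) (fun h => f (h * t⁻¹)) (g * t) (rightVec E (g * t) X)
      = modelDeriv 𝓘(ℝ, E) 𝓘(ℝ, ℝ) f g (rightVec E g X) := by
  have hf' : MDifferentiableAt 𝓘(ℝ, E) 𝓘(ℝ, ℝ) f (g * t * t⁻¹) := by rwa [mul_inv_cancel_right]
  rw [modelDeriv_comp (g * t) (g := f) (f := fun h => h * t⁻¹) hf'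
    (mdifferentiable_mul_right (E := E) _ _), modelDeriv_mul_right_rightVec, mul_inv_cancel_right]

variable [LieGroup 𝓘(ℝ, E) ∞ G] [LieGroup 𝓘(ℝ, E') ∞ G']
  {c : ℝ → G'} (hc : IsOneParameterSubgroup c P.Z) (hχ : P.IsCharacter T₀ χ)

include hc hχ

theorem eventually_mul_mem {t : G'} (ht : t ∈ T₀) : ∀ᶠ τ in 𝓝 (0 : ℝ), c τ * t ∈ T₀ := by
  obtain ⟨O, hO, rfl⟩ := hχ.relOpen
  have hcont : ContinuousAt (fun τ => c τ * t) 0 :=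
    ((contMDiff_mul_right (I := 𝓘(ℝ, E')) (n := ∞) (a := t)).continuous.comp
      hc.contMDiff.continuous).continuousAt
  filter_upwards [hcont (hO.mem_nhds (by beta_reduce; rw [hc.map_zero, one_mul]; exact ht.1))] with τ hτ
  exact ⟨hτ, P.T.mul_mem (CentralExtension.mem_T hc τ) ht.2⟩

theorem eventually_mem : ∀ᶠ τ in 𝓝 (0 : ℝ), c τ ∈ T₀ := by
  simpa using eventually_mul_mem hc hχ hχ.one_mem

theorem eventually_apply_eq_exp (hχZ : HasDerivAt (fun τ => χ (c τ)) (-1) 0) :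
    ∀ᶠ τ in 𝓝 (0 : ℝ), χ (c τ) = Real.exp (-τ) := by
  refine eventually_eq_exp_neg_of_map_add (by rw [hc.map_zero, hχ.map_one]) hχZ ?_
  have hadd : Tendsto (fun p : ℝ × ℝ => p.1 + p.2) (𝓝 (0, 0)) (𝓝 0) := by
    have : ContinuousAt (fun p : ℝ × ℝ => p.1 + p.2) (0, 0) := by fun_prop
    simpa [ContinuousAt] using this
  have h1 := eventually_mem hc hχ
  filter_upwards [hadd.eventually h1, (continuous_fst.tendsto ((0 : ℝ), (0 : ℝ))).eventually h1,
    (continuous_snd.tendsto ((0 : ℝ), (0 : ℝ))).eventually h1] with p h2 h3 h4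
  rw [hc.map_add] at h2 ⊢
  exact hχ.map_mul _ h3 _ h4 h2

variable {V : Set G} {s : G → G'} (hs : P.IsSection V s)
  (hχZ : HasDerivAt (fun τ => χ (c τ)) (-1) 0)
  {g : G} (hg : g ∈ V) {τ : G' → ℝ} (hτ : ContMDiffAt 𝓘(ℝ, E') 𝓘(ℝ, ℝ) ∞ τ (s g))
  (hτ0 : τ (s g) = 0) (hτc : ∀ᶠ h in 𝓝 (s g), s (P.proj h) * c (τ h) = h)

include hτ hτ0 hτc hχZ

/-- Near `s g * t`, the fibre coordinate of `h * t⁻¹` gives `(s (π h))⁻¹ * h = c τ * t`. Relative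
openness of `T₀` keeps `c τ` and `c τ * t` inside `T₀` for small `τ`, where `χ` is multiplicative.
-/
theorem eventually_fibreFun_eq {t : G'} (ht : t ∈ T₀) :
    ∀ᶠ h in 𝓝 (s g * t), P.fibreFun s χ h = χ t * Real.exp (-τ (h * t⁻¹)) := by
  have hmul : Tendsto (fun h : G' => h * t⁻¹) (𝓝 (s g * t)) (𝓝 (s g)) := by
    have := (contMDiff_mul_right (I := 𝓘(ℝ, E')) (n := ∞) (a := t⁻¹)).continuous.continuousAt
      (x := s g * t)
    simpa [ContinuousAt] using this
  have hτt : Tendsto (fun h : G' => τ (h * t⁻¹)) (𝓝 (s g * t)) (𝓝 0) := by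
    have := hτ.continuousAt.tendsto.comp hmul
    rwa [hτ0] at this
  filter_upwards [hmul.eventually hτc, hτt.eventually (eventually_mul_mem hc hχ ht),
    hτt.eventually (eventually_mem hc hχ),
    hτt.eventually (eventually_apply_eq_exp hc hχ hχZ)] with h h1 h2 h3 h4
  have h5 : P.proj (h * t⁻¹) = P.proj h :=
    P.proj_mul_of_mem h (P.T.inv_mem (hχ.mem_T ht))
  rw [h5] at h1
  have h6 : (s (P.proj h))⁻¹ * h = c (τ (h * t⁻¹)) * t := by
    rw [inv_mul_eq_iff_eq_mul, ← mul_assoc, h1, inv_mul_cancel_right]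
  rw [fibreFun, h6, hχ.map_mul _ h3 _ ht h2, h4, mul_comm]

theorem contMDiffAt_fibreFun {t : G'} (ht : t ∈ T₀) :
    ContMDiffAt 𝓘(ℝ, E') 𝓘(ℝ, ℝ) ∞ (P.fibreFun s χ) (s g * t) := by
  refine ContMDiffAt.congr_of_eventuallyEq ?_ (eventually_fibreFun_eq hc hχ hχZ hτ hτ0 hτc ht)
  have h1 : ContMDiffAt 𝓘(ℝ, E') 𝓘(ℝ, ℝ) ∞ (fun h => τ (h * t⁻¹)) (s g * t) := by
    have h2 : ContMDiffAt 𝓘(ℝ, E') 𝓘(ℝ, ℝ) ∞ τ (s g * t * t⁻¹) := by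
      rwa [mul_inv_cancel_right]
    exact ContMDiffAt.comp (g := τ) (f := fun h => h * t⁻¹) (s g * t) h2
      contMDiff_mul_right.contMDiffAt
  have h3 : ContDiff ℝ ∞ fun r : ℝ => χ t * Real.exp (-r) :=
    contDiff_const.mul (Real.contDiff_exp.comp contDiff_neg)
  exact ContMDiffAt.comp (g := fun r : ℝ => χ t * Real.exp (-r)) (s g * t)
    h3.contMDiff.contMDiffAt h1

theorem logDeriv_fibreFun_mul {t : G'} (ht : t ∈ T₀) (X : GroupLieAlgebra 𝓘(ℝ, E) G) :
    P.logDeriv (P.fibreFun s χ) X (s g * t) = -rightDeriv (P.lift X) τ (s g) := by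
  have h2 : MDifferentiableAt 𝓘(ℝ, E') 𝓘(ℝ, ℝ) τ (s g * t * t⁻¹) := by
    rw [mul_inv_cancel_right]
    exact hτ.mdifferentiableAt (by simp)
  have h3 : MDifferentiableAt 𝓘(ℝ, E') 𝓘(ℝ, ℝ) (fun h => τ (h * t⁻¹)) (s g * t) :=
    MDifferentiableAt.comp (g := τ) (f := fun h => h * t⁻¹) (s g * t) h2
      (mdifferentiable_mul_right (E := E') _ _)
  rw [logDeriv_eq_of_eventuallyEq (hχ.ne_zero t ht) h3
    (eventually_fibreFun_eq hc hχ hχZ hτ hτ0 hτc ht)]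
  exact congrArg Neg.neg
    (modelDeriv_comp_mul_right (E := E') (hτ.mdifferentiableAt (by simp)) t (P.lift X : E'))

theorem potential_eq (X : GroupLieAlgebra 𝓘(ℝ, E) G) :
    P.potential s χ X g = -rightDeriv (P.lift X) τ (s g) := by
  have := logDeriv_fibreFun_mul hc hχ hχZ hτ hτ0 hτc hχ.one_mem X
  rwa [mul_one] at this

theorem eventually_logDeriv_eq (X : GroupLieAlgebra 𝓘(ℝ, E) G) :
    ∀ᶠ h in 𝓝 (s g), P.logDeriv (P.fibreFun s χ) X h = -rightDeriv (P.lift X) τ h := by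
  have h1 := eventually_fibreFun_eq hc hχ hχZ hτ hτ0 hτc hχ.one_mem
  simp only [mul_one, inv_one, hχ.map_one] at h1
  filter_upwards [h1.eventually_nhds, eventually_mdifferentiableAt hτ] with h h2 h3
  exact logDeriv_eq_of_eventuallyEq one_ne_zero h3 (by simpa only [one_mul, EventuallyEq] using h2) X

include hs hg

omit hτ hτ0 hτc in
theorem logDeriv_fibreFun_mul_eq_potential [FiniteDimensional ℝ E] [FiniteDimensional ℝ E']
    {t : G'} (ht : t ∈ T₀) (X : GroupLieAlgebra 𝓘(ℝ, E) G) :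
    P.logDeriv (P.fibreFun s χ) X (s g * t) = P.potential s χ X g := by
  obtain ⟨τ, hτ, hτ0, hτc⟩ := exists_fibre_coordinate hc hs hg
  rw [logDeriv_fibreFun_mul hc hχ hχZ hτ hτ0 hτc ht, potential_eq hc hχ hχZ hτ hτ0 hτc]

theorem eventually_potential_eq (X : GroupLieAlgebra 𝓘(ℝ, E) G) :
    ∀ᶠ g' in 𝓝 g, P.potential s χ X g' = -rightDeriv (P.lift X) τ (s g') :=
  (hs.contMDiffAt hg).continuousAt.eventually (eventually_logDeriv_eq hc hχ hχZ hτ hτ0 hτc X)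

theorem contMDiffAt_potential (X : GroupLieAlgebra 𝓘(ℝ, E) G) :
    ContMDiffAt 𝓘(ℝ, E) 𝓘(ℝ, ℝ) ∞ (P.potential s χ X) g := by
  refine ContMDiffAt.congr_of_eventuallyEq ?_
    (eventually_potential_eq hc hχ hs hχZ hg hτ hτ0 hτc X)
  exact (ContMDiffAt.comp g (contMDiffAt_rightDeriv hτ (P.lift X)) (hs.contMDiffAt hg)).neg

/-- This identity off the section is needed to differentiate along `η̃_X`, which need not be tangent
to the section. It comes from the constancy of the logarithmic derivative along the fibre, at `h = s
(π h) * c (τ h)`. -/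
theorem eventually_potential_proj_eq [FiniteDimensional ℝ E] [FiniteDimensional ℝ E']
    (X : GroupLieAlgebra 𝓘(ℝ, E) G) :
    ∀ᶠ h in 𝓝 (s g), P.potential s χ X (P.proj h) = -rightDeriv (P.lift X) τ h := by
  have hτt : Tendsto τ (𝓝 (s g)) (𝓝 0) := by
    have := hτ.continuousAt.tendsto
    rwa [hτ0] at this
  have hV : ∀ᶠ h in 𝓝 (s g), P.proj h ∈ V := by
    refine P.contMDiff_proj.continuous.continuousAt (hs.isOpen.mem_nhds ?_)
    rwa [hs.proj_apply g hg]
  filter_upwards [hτc, hV, hτt.eventually (eventually_mem hc hχ),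
    eventually_logDeriv_eq hc hχ hχZ hτ hτ0 hτc X] with h h1 h2 h3 h4
  rw [← h4, ← logDeriv_fibreFun_mul_eq_potential hc hχ hs hχZ h2 h3 X, h1]

omit hχ hχZ hτ0 [LieGroup 𝓘(ℝ, E) ∞ G] in
/-- Every tangent vector at `s g` in the coordinates `(g, τ) ↦ s g * c τ`. -/
theorem modelDeriv_section_mul_coordinates (hτ0 : τ (s g) = 0) (w : E') :
    modelDeriv (𝓘(ℝ, E).prod 𝓘(ℝ, ℝ)) 𝓘(ℝ, E') (fun q : G × ℝ => s q.1 * c q.2) (g, 0)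
      (modelDeriv 𝓘(ℝ, E') 𝓘(ℝ, E) P.proj (s g) w, modelDeriv 𝓘(ℝ, E') 𝓘(ℝ, ℝ) τ (s g) w) = w := by
  have hτd := hτ.mdifferentiableAt (by simp : (∞ : WithTop ℕ∞) ≠ 0)
  have hd : MDifferentiableAt (𝓘(ℝ, E).prod 𝓘(ℝ, ℝ)) 𝓘(ℝ, E')
      (fun q : G × ℝ => s q.1 * c q.2) (P.proj (s g), τ (s g)) := by
    rw [hs.proj_apply g hg, hτ0]
    exact mdifferentiableAt_section_mul hc hs hg 0
  have h1 := modelDeriv_comp (I' := 𝓘(ℝ, E).prod 𝓘(ℝ, ℝ)) (s g)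
    (f := fun h => (P.proj h, τ h)) hd ((P.mdifferentiable_proj _).prodMk hτd) w
  rw [modelDeriv_congr (hτc : (fun h => s (P.proj h) * c (τ h)) =ᶠ[𝓝 (s g)] fun h => h),
    modelDeriv_id, modelDeriv_prodMk (P.mdifferentiable_proj _) hτd, hs.proj_apply g hg,
    hτ0] at h1
  exact h1.symm

-- In the coordinates `(g, τ)` the vector `η̃_Z` is `(0, -1)`, and `τ` reads off the second
-- component.
omit hχ hχZ hτ0 in
theorem rightDeriv_Z_coordinate (hτ0 : τ (s g) = 0) : rightDeriv P.Z τ (s g) = -1 := by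
  have h1 := modelDeriv_section_mul_coordinates hc hs hg hτ hτc hτ0
    (rightVec E' (s g) (P.Z : E'))
  have h2 := modelDeriv_section_mul_zero hc hs hg 0 (-1)
  have h3 : modelDeriv (𝓘(ℝ, E).prod 𝓘(ℝ, ℝ)) 𝓘(ℝ, E') (fun q : G × ℝ => s q.1 * c q.2) (g, 0)
      (0, -1) = rightVec E' (s g) (P.Z : E') := by
    refine h2.trans ?_
    rw [neg_smul, neg_neg, one_smul, hc.map_zero, mul_one]
  exact congrArg Prod.snd (injective_modelDeriv_section_mul hc hs hg 0 (h1.trans h3.symm))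

-- Both second derivatives are computed upstairs as derivatives of `-τ`. Their commutator contains
-- the extra term `B X Y • Z` of the extended bracket, and `η̃_Z τ = -1` turns it into `B X Y`.
omit hτ hτ0 hτc in
theorem coboundaryOne_potential [FiniteDimensional ℝ E] [FiniteDimensional ℝ E']
    (X Y : GroupLieAlgebra 𝓘(ℝ, E) G) : coboundaryOne (P.potential s χ) X Y g = B X Y := by
  have : CompleteSpace E' := FiniteDimensional.complete ℝ E'
  obtain ⟨τ, hτ, hτ0, hτc⟩ := exists_fibre_coordinate hc hs hg
  have key (X Y : GroupLieAlgebra 𝓘(ℝ, E) G) : rightDeriv X (P.potential s χ Y) g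
      = -rightDeriv (P.lift X) (rightDeriv (P.lift Y) τ) (s g) := by
    have h1 := P.modelDeriv_proj_rightVec (P.lift X : E') (s g)
    rw [P.modelDeriv_proj_lift, hs.proj_apply g hg] at h1
    have hp : MDifferentiableAt 𝓘(ℝ, E) 𝓘(ℝ, ℝ) (P.potential s χ Y) (P.proj (s g)) := by
      rw [hs.proj_apply g hg]
      exact (contMDiffAt_potential hc hχ hs hχZ hg hτ hτ0 hτc Y).mdifferentiableAt (by simp)
    have h2 := modelDeriv_comp (s g) hp (P.mdifferentiable_proj (s g))
      (rightVec E' (s g) (P.lift X : E'))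
    rw [h1, hs.proj_apply g hg,
      modelDeriv_congr (eventually_potential_proj_eq hc hχ hs hχZ hg hτ hτ0 hτc Y)] at h2
    refine h2.symm.trans ?_
    exact DFunLike.congr_fun (F := E' →L[ℝ] ℝ) (mfderiv_neg (f := rightDeriv (P.lift Y) τ) (x := s g)) _
  have hcomm := rightDeriv_commutator hτ (P.lift X) (P.lift Y)
  rw [P.bracket_lift, rightDeriv_add_left, rightDeriv_smul_left,
    rightDeriv_Z_coordinate hc hs hg hτ hτc hτ0] at hcomm
  rw [coboundaryOne, key, key, potential_eq hc hχ hχZ hτ hτ0 hτc]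
  linarith

end Character

end CentralExtension

/-! ### The constant cocycle of a right-invariant form and the linearity of the coboundary -/

section Cochains

variable {E : Type*} [NormedAddCommGroup E] [NormedSpace ℝ E]
  {G : Type*} [TopologicalSpace G] [ChartedSpace E G] [Group G]

theorem cochainOfForm_eq {F : BilinField E G} (hF : IsRightInvariant F)
    (X Y : GroupLieAlgebra 𝓘(ℝ, E) G) (g : G) : cochainOfForm F X Y g = F 1 X Y := by
  -- Right-invariance is stated at the base point `1 * g`, whose tangent space is a different
  -- dependent type from that at `g`.
  have transport (k : G) (hk : k = g) (u v : E) :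
      (F k : E →ₗ[ℝ] E →ₗ[ℝ] ℝ) u v = (F g : E →ₗ[ℝ] E →ₗ[ℝ] ℝ) u v := by subst hk; rfl
  have neg_neg_apply (L : E →ₗ[ℝ] E →ₗ[ℝ] ℝ) (u v : E) : L (-u) (-v) = L u v := by simp
  refine (neg_neg_apply (F g) (modelDeriv 𝓘(ℝ, E) 𝓘(ℝ, E) (fun h : G => h * g) 1 X)
    (modelDeriv 𝓘(ℝ, E) 𝓘(ℝ, E) (fun h : G => h * g) 1 Y)).trans ?_
  exact (transport (1 * g) (one_mul g) _ _).symm.trans (hF g 1 X Y)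

theorem IsOneCochain.mdifferentiableAt {V : Set G} (hV : IsOpen V)
    {A : GroupLieAlgebra 𝓘(ℝ, E) G →ₗ[ℝ] (G → ℝ)} (hA : IsOneCochain V A)
    (X : GroupLieAlgebra 𝓘(ℝ, E) G) {g : G} (hg : g ∈ V) :
    MDifferentiableAt 𝓘(ℝ, E) 𝓘(ℝ, ℝ) (A X) g :=
  ((hA X).contMDiffAt (hV.mem_nhds hg)).mdifferentiableAt (by simp)

theorem coboundaryOne_add {V : Set G} (hV : IsOpen V)
    {A A' : GroupLieAlgebra 𝓘(ℝ, E) G →ₗ[ℝ] (G → ℝ)} (hA : IsOneCochain V A)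
    (hA' : IsOneCochain V A') (X Y : GroupLieAlgebra 𝓘(ℝ, E) G) {g : G} (hg : g ∈ V) :
    coboundaryOne (A + A') X Y g = coboundaryOne A X Y g + coboundaryOne A' X Y g := by
  simp only [coboundaryOne, LinearMap.add_apply, Pi.add_apply]
  rw [rightDeriv_add (hA.mdifferentiableAt hV Y hg) (hA'.mdifferentiableAt hV Y hg),
    rightDeriv_add (hA.mdifferentiableAt hV X hg) (hA'.mdifferentiableAt hV X hg)]
  ring

theorem coboundaryOne_sub {V : Set G} (hV : IsOpen V)
    {A A' : GroupLieAlgebra 𝓘(ℝ, E) G →ₗ[ℝ] (G → ℝ)} (hA : IsOneCochain V A)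
    (hA' : IsOneCochain V A') (X Y : GroupLieAlgebra 𝓘(ℝ, E) G) {g : G} (hg : g ∈ V) :
    coboundaryOne (A - A') X Y g = coboundaryOne A X Y g - coboundaryOne A' X Y g := by
  simp only [coboundaryOne, LinearMap.sub_apply, Pi.sub_apply]
  rw [rightDeriv_sub (hA.mdifferentiableAt hV Y hg) (hA'.mdifferentiableAt hV Y hg),
    rightDeriv_sub (hA.mdifferentiableAt hV X hg) (hA'.mdifferentiableAt hV X hg)]
  ring

variable [LieGroup 𝓘(ℝ, E) ∞ G]

theorem isOneCochain_coboundaryZero {V : Set G} (hV : IsOpen V) {φ : G → ℝ}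
    (hφ : IsSmoothOn (E := E) V φ) : IsOneCochain V (coboundaryZero (E := E) φ) := fun X _ hg =>
  (contMDiffAt_rightDeriv (hφ.contMDiffAt (hV.mem_nhds hg)) X).contMDiffWithinAt

theorem coboundaryOne_coboundaryZero [CompleteSpace E] {φ : G → ℝ} {g : G}
    (hφ : ContMDiffAt 𝓘(ℝ, E) 𝓘(ℝ, ℝ) ∞ φ g) (X Y : GroupLieAlgebra 𝓘(ℝ, E) G) :
    coboundaryOne (coboundaryZero φ) X Y g = 0 :=
  sub_eq_zero.2 (rightDeriv_commutator hφ X Y)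

end Cochains

namespace CentralExtension

/-! ### The invariant fields in the coordinates `(g, g⁰)` -/

section Coordinates

variable {E : Type*} [NormedAddCommGroup E] [NormedSpace ℝ E]
  {G : Type*} [TopologicalSpace G] [ChartedSpace E G] [Group G] [LieGroup 𝓘(ℝ, E) ∞ G]
  {E' : Type*} [NormedAddCommGroup E'] [NormedSpace ℝ E']
  {G' : Type*} [TopologicalSpace G'] [ChartedSpace E' G'] [Group G'] [LieGroup 𝓘(ℝ, E') ∞ G']
  {B : GroupLieAlgebra 𝓘(ℝ, E) G →ₗ[ℝ] GroupLieAlgebra 𝓘(ℝ, E) G →ₗ[ℝ] ℝ}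
  {P : CentralExtension (E' := E') G' B} {c : ℝ → G'} {V : Set G} {s : G → G'}

theorem rightField_Z_eq_coordVector (hc : IsOneParameterSubgroup c P.Z) (hs : P.IsSection V s)
    {g : G} (hg : g ∈ V) (τ : ℝ) :
    rightField P.Z (s g * c τ) = coordVector (E := E) (E' := E') s c g τ 0 (-1) := by
  have h := modelDeriv_section_mul_zero hc hs hg τ (-1)
  rw [neg_smul, neg_neg, one_smul] at h
  exact h.symm

omit [LieGroup 𝓘(ℝ, E) ∞ G] in
/-- Right translation along the fibre in the coordinates `(g, τ) ↦ s g * c τ`. -/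
theorem modelDeriv_mul_right_section_mul (hc : IsOneParameterSubgroup c P.Z)
    (hs : P.IsSection V s) {g : G} (hg : g ∈ V) (τ : ℝ) (v : E) (r : ℝ) :
    modelDeriv 𝓘(ℝ, E') 𝓘(ℝ, E') (fun h : G' => h * c τ) (s g)
        (modelDeriv (𝓘(ℝ, E).prod 𝓘(ℝ, ℝ)) 𝓘(ℝ, E') (fun q : G × ℝ => s q.1 * c q.2) (g, 0) (v, r))
      = modelDeriv (𝓘(ℝ, E).prod 𝓘(ℝ, ℝ)) 𝓘(ℝ, E') (fun q : G × ℝ => s q.1 * c q.2) (g, τ)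
          (v, r) := by
  have hadd : MDifferentiableAt 𝓘(ℝ, ℝ) 𝓘(ℝ, ℝ) (fun σ : ℝ => σ + τ) 0 :=
    (differentiableAt_id.add_const τ).mdifferentiableAt
  have hsnd : MDifferentiableAt (𝓘(ℝ, E).prod 𝓘(ℝ, ℝ)) 𝓘(ℝ, ℝ) (fun q : G × ℝ => q.2 + τ) (g, 0) :=
    MDifferentiableAt.comp (g := fun σ : ℝ => σ + τ) (f := Prod.snd) (g, (0 : ℝ)) hadd
      mdifferentiableAt_snd
  have hfst : MDifferentiableAt (𝓘(ℝ, E).prod 𝓘(ℝ, ℝ)) 𝓘(ℝ, E) (fun q : G × ℝ => q.1) (g, 0) :=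
    mdifferentiableAt_fst
  have h0 : s g * c 0 = s g := by rw [hc.map_zero, mul_one]
  have h1 := modelDeriv_comp (I := 𝓘(ℝ, E).prod 𝓘(ℝ, ℝ)) (g, (0 : ℝ)) (g := fun h : G' => h * c τ)
    (f := fun q : G × ℝ => s q.1 * c q.2) (mdifferentiable_mul_right (E := E') _ _)
    (mdifferentiableAt_section_mul hc hs hg 0) (v, r)
  have hd : MDifferentiableAt (𝓘(ℝ, E).prod 𝓘(ℝ, ℝ)) 𝓘(ℝ, E')
      (fun q : G × ℝ => s q.1 * c q.2) (g, 0 + τ) := mdifferentiableAt_section_mul hc hs hg _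
  have h2 := modelDeriv_comp (I := 𝓘(ℝ, E).prod 𝓘(ℝ, ℝ)) (I' := 𝓘(ℝ, E).prod 𝓘(ℝ, ℝ))
    (g, (0 : ℝ)) (g := fun q : G × ℝ => s q.1 * c q.2) (f := fun q : G × ℝ => (q.1, q.2 + τ))
    hd (hfst.prodMk hsnd) (v, r)
  have h3 : modelDeriv (𝓘(ℝ, E).prod 𝓘(ℝ, ℝ)) 𝓘(ℝ, ℝ) (fun q : G × ℝ => q.2 + τ) (g, 0) (v, r)
      = r := by
    have h4 := modelDeriv_comp (I := 𝓘(ℝ, E).prod 𝓘(ℝ, ℝ)) (g, (0 : ℝ)) (g := fun σ : ℝ => σ + τ)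
      (f := fun q : G × ℝ => q.2) hadd mdifferentiableAt_snd (v, r)
    rw [modelDeriv_eq_fderiv, fderiv_add_const, fderiv_fun_id] at h4
    refine h4.trans ?_
    exact DFunLike.congr_fun (F := E × ℝ →L[ℝ] ℝ) (mfderiv_snd (I := 𝓘(ℝ, E)) (I' := 𝓘(ℝ, ℝ))
      (x := (g, (0 : ℝ)))) (v, r)
  have h5 : modelDeriv (𝓘(ℝ, E).prod 𝓘(ℝ, ℝ)) 𝓘(ℝ, E) (fun q : G × ℝ => q.1) (g, 0) (v, r) = v :=
    DFunLike.congr_fun (F := E × ℝ →L[ℝ] E) (mfderiv_fst (I := 𝓘(ℝ, E)) (I' := 𝓘(ℝ, ℝ))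
      (x := (g, (0 : ℝ)))) (v, r)
  rw [modelDeriv_prodMk hfst hsnd, h3, h5] at h2
  simp only [zero_add, h0] at h1 h2
  rw [← h1, ← h2]
  congr 2
  funext q
  rw [hc.map_add, mul_assoc]

theorem rightField_lift_eq_coordVector_iff [FiniteDimensional ℝ E] [FiniteDimensional ℝ E']
    {T₀ : Set G'} {χ : G' → ℝ} (hc : IsOneParameterSubgroup c P.Z) (hs : P.IsSection V s)
    (hχ : P.IsCharacter T₀ χ) (hχZ : HasDerivAt (fun τ => χ (c τ)) (-1) 0) {g : G} (hg : g ∈ V)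
    (τ : ℝ) (X : GroupLieAlgebra 𝓘(ℝ, E) G) (r : ℝ) :
    rightField (P.lift X) (s g * c τ)
        = coordVector (E := E) (E' := E') s c g τ (rightField X g) r
      ↔ r = -P.potential s χ X g := by
  obtain ⟨k, hk, hk0, hkc⟩ := exists_fibre_coordinate hc hs hg
  have h1 := P.modelDeriv_proj_rightVec (P.lift X : E') (s g)
  rw [P.modelDeriv_proj_lift, hs.proj_apply g hg] at h1
  have h2 := modelDeriv_section_mul_coordinates hc hs hg hk hkc hk0
    (rightVec E' (s g) (P.lift X : E'))
  rw [h1] at h2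
  have h3 := modelDeriv_mul_right_section_mul hc hs hg τ (rightVec E g X)
    (rightDeriv (P.lift X) k (s g))
  -- The decomposition at `s g` is moved to `s g * c τ` by right translation, which preserves `η̃_X`
  -- and both coordinate components. The coefficient is therefore independent of `τ`.
  have h4 : modelDeriv (𝓘(ℝ, E).prod 𝓘(ℝ, ℝ)) 𝓘(ℝ, E') (fun q : G × ℝ => s q.1 * c q.2) (g, τ)
      (rightVec E g X, rightDeriv (P.lift X) k (s g)) = rightField (P.lift X) (s g * c τ) := by
    refine h3.symm.trans ((congrArg _ h2).trans ?_)
    exact modelDeriv_mul_right_rightVec (E := E') (P.lift X : E') (s g) (c τ)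
  rw [potential_eq hc hχ hχZ hk hk0 hkc, neg_neg]
  constructor
  · intro h
    exact congrArg Prod.snd (injective_modelDeriv_section_mul hc hs hg τ (h.symm.trans h4.symm))
  · rintro rfl
    exact h4.symm

theorem isOneCochain_potential [FiniteDimensional ℝ E] [FiniteDimensional ℝ E']
    {T₀ : Set G'} {χ : G' → ℝ} (hc : IsOneParameterSubgroup c P.Z) (hs : P.IsSection V s)
    (hχ : P.IsCharacter T₀ χ) (hχZ : HasDerivAt (fun τ => χ (c τ)) (-1) 0) :
    IsOneCochain V (P.potential s χ) := fun X g hg => by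
  obtain ⟨k, hk, hk0, hkc⟩ := exists_fibre_coordinate hc hs hg
  exact (contMDiffAt_potential hc hχ hs hχZ hg hk hk0 hkc X).contMDiffWithinAt

end Coordinates

end CentralExtension

end MagneticLie

end

/-! ### The main theorem -/

theorem mainTheorem4
    {E : Type*} [NormedAddCommGroup E] [NormedSpace ℝ E] [FiniteDimensional ℝ E]
    {G : Type*} [TopologicalSpace G] [T2Space G] [ConnectedSpace G] [ChartedSpace E G] [Group G]
    [LieGroup 𝓘(ℝ, E) ∞ G]
    {E' : Type*} [NormedAddCommGroup E'] [NormedSpace ℝ E'] [FiniteDimensional ℝ E']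
    {G' : Type*} [TopologicalSpace G'] [T2Space G'] [ConnectedSpace G'] [ChartedSpace E' G']
    [Group G'] [LieGroup 𝓘(ℝ, E') ∞ G']
    (F : MagneticLie.BilinField E G) (hF_alt : ∀ g u, F g u u = 0)
    (hF_inv : MagneticLie.IsRightInvariant F) (hF_closed : MagneticLie.IsClosedForm F)
    (P : MagneticLie.CentralExtension (E' := E') G' (F 1))
    (V : Set G) (s : G → G') (hs : P.IsSection V s)
    (c : ℝ → G') (hc : MagneticLie.IsOneParameterSubgroup c P.Z)
    (T₀ : Set G') (χ : G' → ℝ) (hχ : P.IsCharacter T₀ χ)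
    (hχZ : HasDerivAt (fun τ => χ (c τ)) (-1) 0)
    {ι : Type*} (e : Module.Basis ι ℝ (GroupLieAlgebra 𝓘(ℝ, E) G)) :
    -- `U` is smooth and `U⁻¹ (η̃_X U)` is constant along the fibres
    (∀ g ∈ V, ∀ t ∈ T₀,
      ContMDiffAt 𝓘(ℝ, E') 𝓘(ℝ, ℝ) ∞ (P.fibreFun s χ) (s g * t) ∧
      ∀ X, P.logDeriv (P.fibreFun s χ) X (s g * t) = P.potential s χ X g) ∧
    -- every `U⁻¹ (η̃_X U) |_G + δφ` is a `1`-cochain that solves `δA = 𝐅`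
    (∀ φ : G → ℝ, MagneticLie.IsSmoothOn (E := E) V φ →
      MagneticLie.IsOneCochain V (P.potential s χ + MagneticLie.coboundaryZero φ) ∧
      ∀ X Y, ∀ g ∈ V,
        MagneticLie.coboundaryOne (P.potential s χ + MagneticLie.coboundaryZero φ) X Y g
          = MagneticLie.cochainOfForm F X Y g) ∧
    -- every solution has this form
    (SimplyConnectedSpace V → ∀ A : GroupLieAlgebra 𝓘(ℝ, E) G →ₗ[ℝ] (G → ℝ),
      MagneticLie.IsOneCochain V A →
      (∀ X Y, ∀ g ∈ V,
        MagneticLie.coboundaryOne A X Y g = MagneticLie.cochainOfForm F X Y g) →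
      ∃ φ : G → ℝ, MagneticLie.IsSmoothOn (E := E) V φ ∧
        ∀ X, ∀ g ∈ V, A X g = P.potential s χ X g + MagneticLie.coboundaryZero φ X g) ∧
    -- the components in local coordinates
    (∃ η₀ : ι → G → ℝ,
      (∀ g ∈ V, ∀ τ : ℝ,
        MagneticLie.rightField P.Z (s g * c τ)
            = MagneticLie.CentralExtension.coordVector (E := E) (E' := E') s c g τ 0 (-1) ∧
        ∀ (a : ι) (r : ℝ),
          MagneticLie.rightField (P.lift (e a)) (s g * c τ)
              = MagneticLie.CentralExtension.coordVector (E := E) (E' := E') s c g τ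
                  (MagneticLie.rightField (e a) g) r ↔ r = η₀ a g) ∧
      (∀ φ : G → ℝ, MagneticLie.IsSmoothOn (E := E) V φ → ∀ a, ∀ g ∈ V,
        P.potential s χ (e a) g + MagneticLie.coboundaryZero φ (e a) g
          = -η₀ a g + MagneticLie.rightDeriv (e a) φ g)) := by
  have : CompleteSpace E := FiniteDimensional.complete ℝ E
  have hV := hs.isOpen
  have hpot := MagneticLie.CentralExtension.isOneCochain_potential hc hs hχ hχZ
  have hδ : ∀ X Y, ∀ g ∈ V, MagneticLie.coboundaryOne (P.potential s χ) X Y g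
      = MagneticLie.cochainOfForm F X Y g := by
    intro X Y g hg
    rw [MagneticLie.CentralExtension.coboundaryOne_potential hc hχ hs hχZ hg,
      MagneticLie.cochainOfForm_eq hF_inv]
  refine ⟨fun g hg t ht => ⟨?_, fun X => ?_⟩, fun φ hφ => ⟨fun X => ?_, fun X Y g hg => ?_⟩,
    fun hsc A hA hAF => ?_, fun a g => -P.potential s χ (e a) g,
    fun g hg τ => ⟨?_, fun a r => ?_⟩, fun φ _ a g _ => ?_⟩
  · obtain ⟨k, hk, hk0, hkc⟩ := MagneticLie.CentralExtension.exists_fibre_coordinate hc hs hg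
    exact MagneticLie.CentralExtension.contMDiffAt_fibreFun hc hχ hχZ hk hk0 hkc ht
  · exact MagneticLie.CentralExtension.logDeriv_fibreFun_mul_eq_potential hc hχ hs hχZ hg ht X
  · exact (hpot X).add (MagneticLie.isOneCochain_coboundaryZero hV hφ X)
  · rw [MagneticLie.coboundaryOne_add hV hpot (MagneticLie.isOneCochain_coboundaryZero hV hφ) X Y hg,
      MagneticLie.coboundaryOne_coboundaryZero (hφ.contMDiffAt (hV.mem_nhds hg)), add_zero,
      hδ X Y g hg]
  -- Two solutions of `δA = 𝐅` differ by a closed cochain, whose primitive is the required `φ`.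
  · obtain ⟨φ, hφ, hφd⟩ := MagneticLie.exists_primitive hV (B := A - P.potential s χ)
      (fun X => (hA X).sub (hpot X)) (fun X Y g hg => by
        rw [MagneticLie.coboundaryOne_sub hV hA hpot X Y hg, hAF X Y g hg, hδ X Y g hg, sub_self])
    refine ⟨φ, hφ, fun X g hg => ?_⟩
    have h := hφd X g hg
    have h' : MagneticLie.coboundaryZero φ X g = A X g - P.potential s χ X g := h
    rw [h']
    ring
  · exact MagneticLie.CentralExtension.rightField_Z_eq_coordVector hc hs hg τ
  · exact MagneticLie.CentralExtension.rightField_lift_eq_coordVector_iff hc hs hχ hχZ hg τ (e a) r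
  · rw [neg_neg]
    rfl
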